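/- **Setting.** Let $n>1$. The types of $Ty_n$ are built from the truth type $t$ and individual types $e_1,\dots,e_n$ by functional types $\alpha\beta$ (functions from $\alpha$ to $\beta$; association to the right) and product types $\alpha\times\beta$. Terms are built from variables $x^i_\alpha$ ($i\in\mathbb N$), non-logical constants and description operators $\iota_{(\alpha t)\alpha}$ by application, abstraction $\lambda x_\alpha A_\beta$, equality $A_\alpha=B_\alpha$ (of type $t$), pairs and projections; formulas are terms of type $t$. Connectives and quantifiers are defined from equality and abstraction as usual: $\top:=(\lambda x_t x_t=\lambda x_t x_t)$, $\forall x_\alpha A:=(\lambda x_\alpha\top=\lambda x_\alpha A)$, $\bot:=\forall x_t\,x_t$, $\neg A:=(\bot=A)$, $A\wedge B:=(\lambda x_t\lambda y_t(\lambda g_{ttt}\,g\top\top=\lambda g_{ttt}\,g\,x_t\,y_t))AB$, $A\vee B:=\neg(\neg A\wedge\neg B)$, $A\to B:=(A=(A\wedge B))$. The logical axioms are all instances of $(G\top\wedge G\bot)=\forall x_t(Gx_t)$; $A=B\to HA=HB$ ($H$ of type $\alpha t$); $(F=G)=\forall x_\alpha(Fx_\alpha=Gx_\alpha)$; $(\lambda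 x_\alpha A)B=A[B/x_\alpha]$ with $B$ free for $x_\alpha$ in $A$; $\iota(\lambda x_\alpha(A=x_\alpha))=A$; $\pi_1(A,B)=A$; $\pi_2(A,B)=B$; $(\pi_1A,\pi_2A)=A$ (where the variable bound in the first, third and fifth schema is not free in $G$; in $F,G$; in $A$). The only rule is: from $A=B$ and $\varphi$ infer the result of replacing one occurrence of $A$ in $\varphi$ by $B$. For a set $\Delta$ of formulas, $\Delta\vdash\varphi$ means that $\psi_1\to\dots\to\psi_k\to\varphi$ is a theorem for some $\psi_1,\dots,\psi_k\in\Delta$ (free variables of $\Delta$ are not generalized), and $\Delta$ is consistent if $\Delta\not\vdash\bot$. Let $\mathcal A=\{a_1,\dots,a_N\}$ be a finite alphabet and $s:=e_n$. Suppose that $Ty_n$ has (besides arbitrary other non-logical constants) distinct constants $\mathbf C^0_{sss}$ and $\mathbf C^0_s,\dots,\mathbf C^N_s$; write $A+B$ for $\mathbf C^0_{sss}AB$. $Ty_n^{\mathcal A}$ is the extension of $Ty_n$ by the axioms $$\forall x_s(x_s+\mathbf C^0_s=x_s\wedge \mathbf C^0_s+x_s=x_s),\qquad \forall x_s\forall y_s\forall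 z_s((x_s+y_s)+z_s=x_s+(y_s+z_s)),$$ $$\forall x_s\forall y_s\forall z_s(x_s+\mathbf C^i_s+y_s\ne x_s+\mathbf C^j_s+z_s)\qquad(1\le i<j\le N).$$ For words put $T_A(\varepsilon)=\mathbf C^0_s$, $T_A(a_i)=\mathbf C^i_s$, $T_A(a_iw)=\mathbf C^i_s+T_A(w)$ for $w\neq\varepsilon$. An *$\alpha$-language* is a set $\mathcal L$ of pairs $(w,A_\alpha)$ of a word $w\in\mathcal A^*$ and a term $A_\alpha$ of $Ty_n^{\mathcal A}$ of type $\alpha$ (free variables are allowed). It is *logically closed* if whenever $(w,B_\alpha),(w,C_\alpha)\in\mathcal L$ and $A_\alpha=B_\alpha\vee A_\alpha=C_\alpha$ is a theorem of $Ty_n^{\mathcal A}$, then $(w,A_\alpha)\in\mathcal L$. Let $Ty_n^{\mathcal A+}$ be an extension of $Ty_n^{\mathcal A}$ by additional non-logical constants. $\mathcal L$ is *represented by* $(\Delta,L_{s\alpha t})$, where $\Delta$ is a consistent set of $Ty_n^{\mathcal A+}$ formulas and $L_{s\alpha t}$ a $Ty_n^{\mathcal A+}$ term, if for all words $w$ and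 all $Ty_n^{\mathcal A}$ terms $A_\alpha$ $$(w,A_\alpha)\in\mathcal L\iff\Delta\vdash L_{s\alpha t}\;T_A(w)\;A_\alpha\quad\text{in }Ty_n^{\mathcal A+}.$$ $\mathcal L$ is *$Ty_n$-representable* if it is represented by some $(\Delta,L_{s\alpha t})$ in some such extension. **Theorem.** Let $\mathcal L$ be an $\alpha$-language. 1. If $\mathcal L$ is $Ty_n$-representable, then it is logically closed. 2. Suppose $N\ne1$. If $\mathcal L$ is logically closed and $Ty_n^{\mathcal A+}$ is any extension of $Ty_n^{\mathcal A}$ by additional constants which include a constant $\mathbf C$ of type $s\alpha t$ that does not belong to $Ty_n^{\mathcal A}$, then $\Delta_{\mathcal L}:=\{\mathbf C\;T_A(w)\;A_\alpha : (w,A_\alpha)\in\mathcal L\}$ is consistent and $(\Delta_{\mathcal L},\mathbf C)$ represents $\mathcal L$. 3. Consequently, if $N\neq1$, then $\mathcal L$ is $Ty_n$-representable if and only if it is logically closed. -/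

import Mathlib

universe u v

namespace TyN

/-- Types of `Ty_n`: the truth type `t`, individual types of `n` sorts, functional types
`fn α β` (from `α` to `β`) and product types. -/
inductive Ty (n : ℕ) : Type where
  | t : Ty n
  | e : Fin n → Ty n
  | fn : Ty n → Ty n → Ty n
  | prod : Ty n → Ty n → Ty n
  deriving DecidableEq

/-- Terms of `Ty_n`, where `C α` is the set of non-logical constants of type `α`. The variables of
type `α` are `var i α` with `i : ℕ`; two variables are the same iff both the index and the type
agree. `iota α` is the description operator. -/
inductive Term {n : ℕ} (C : Ty n → Type u) : Ty n → Type u where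
  | var (i : ℕ) (α : Ty n) : Term C α
  | const {α : Ty n} (c : C α) : Term C α
  | iota (α : Ty n) : Term C (Ty.fn (Ty.fn α Ty.t) α)
  | app {α β : Ty n} (A : Term C (Ty.fn α β)) (B : Term C α) : Term C β
  | lam (i : ℕ) (α : Ty n) {β : Ty n} (A : Term C β) : Term C (Ty.fn α β)
  | eq {α : Ty n} (A B : Term C α) : Term C Ty.t
  | pair {α β : Ty n} (A : Term C α) (B : Term C β) : Term C (Ty.prod α β)
  | fst {α β : Ty n} (A : Term C (Ty.prod α β)) : Term C α
  | snd {α β : Ty n} (A : Term C (Ty.prod α β)) : Term C β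

/-- Formulas are terms of type `t`. -/
abbrev Form {n : ℕ} (C : Ty n → Type u) : Type u := Term C Ty.t

namespace Term

variable {n : ℕ} {C : Ty n → Type u}

/-- Renaming of the non-logical constants. -/
def map {D : Ty n → Type v} (f : ∀ α : Ty n, C α → D α) : {β : Ty n} → Term C β → Term D β
  | _, var i α => var i α
  | _, const c => const (f _ c)
  | _, iota α => iota α
  | _, app A B => app (map f A) (map f B)
  | _, lam i α A => lam i α (map f A)
  | _, eq A B => eq (map f A) (map f B)
  | _, pair A B => pair (map f A) (map f B)
  | _, fst A => fst (map f A)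
  | _, snd A => snd (map f A)

/-- `Free i α A`: the variable `var i α` occurs free in `A`. -/
def Free (i : ℕ) (α : Ty n) : {β : Ty n} → Term C β → Prop
  | _, var j γ => j = i ∧ γ = α
  | _, const _ => False
  | _, iota _ => False
  | _, app A B => Free i α A ∨ Free i α B
  | _, lam j γ A => ¬ (j = i ∧ γ = α) ∧ Free i α A
  | _, eq A B => Free i α A ∨ Free i α B
  | _, pair A B => Free i α A ∨ Free i α B
  | _, fst A => Free i α A
  | _, snd A => Free i α A

/-- `subst i B A` replaces all free occurrences of the variable `var i α` in `A` by `B`. Bound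
variables are not renamed, so it is used only together with `FreeFor`. -/
def subst (i : ℕ) {α : Ty n} (B : Term C α) : {β : Ty n} → Term C β → Term C β
  | _, var j γ => if h : j = i ∧ α = γ then h.2 ▸ B else var j γ
  | _, const c => const c
  | _, iota γ => iota γ
  | _, app A A' => app (subst i B A) (subst i B A')
  | _, lam j γ A => if j = i ∧ γ = α then lam j γ A else lam j γ (subst i B A)
  | _, eq A A' => eq (subst i B A) (subst i B A')
  | _, pair A A' => pair (subst i B A) (subst i B A')
  | _, fst A => fst (subst i B A)
  | _, snd A => snd (subst i B A)

/-- `FreeFor i B A`: the term `B` is free for the variable `var i α` in `A`, i.e. no free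
occurrence of that variable in `A` is in the scope of an abstraction over a variable that is free
in `B`. -/
def FreeFor (i : ℕ) {α : Ty n} (B : Term C α) : {β : Ty n} → Term C β → Prop
  | _, var _ _ => True
  | _, const _ => True
  | _, iota _ => True
  | _, app A A' => FreeFor i B A ∧ FreeFor i B A'
  | _, lam j γ A => (j = i ∧ γ = α) ∨ ¬ Free i α A ∨ (¬ Free j γ B ∧ FreeFor i B A)
  | _, eq A A' => FreeFor i B A ∧ FreeFor i B A'
  | _, pair A A' => FreeFor i B A ∧ FreeFor i B A'
  | _, fst A => FreeFor i B A
  | _, snd A => FreeFor i B A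

/-- `Replace A B P Q`: `Q` results from `P` by replacing one occurrence of `A` by `B`. (The
variable of an abstraction is not an occurrence of a term; occurrences in the scope of an
abstraction may be replaced.) -/
inductive Replace {α : Ty n} (A B : Term C α) : {β : Ty n} → Term C β → Term C β → Prop
  | here : Replace A B A B
  | appL {β γ : Ty n} {P P' : Term C (Ty.fn β γ)} (Q : Term C β) :
      Replace A B P P' → Replace A B (app P Q) (app P' Q)
  | appR {β γ : Ty n} (P : Term C (Ty.fn β γ)) {Q Q' : Term C β} :
      Replace A B Q Q' → Replace A B (app P Q) (app P Q')
  | lam (i : ℕ) (γ : Ty n) {β : Ty n} {P P' : Term C β} :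
      Replace A B P P' → Replace A B (lam i γ P) (lam i γ P')
  | eqL {β : Ty n} {P P' : Term C β} (Q : Term C β) :
      Replace A B P P' → Replace A B (eq P Q) (eq P' Q)
  | eqR {β : Ty n} (P : Term C β) {Q Q' : Term C β} :
      Replace A B Q Q' → Replace A B (eq P Q) (eq P Q')
  | pairL {β γ : Ty n} {P P' : Term C β} (Q : Term C γ) :
      Replace A B P P' → Replace A B (pair P Q) (pair P' Q)
  | pairR {β γ : Ty n} (P : Term C β) {Q Q' : Term C γ} :
      Replace A B Q Q' → Replace A B (pair P Q) (pair P Q')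
  | fst {β γ : Ty n} {P P' : Term C (Ty.prod β γ)} :
      Replace A B P P' → Replace A B (fst P) (fst P')
  | snd {β γ : Ty n} {P P' : Term C (Ty.prod β γ)} :
      Replace A B P P' → Replace A B (snd P) (snd P')

/-! Logical symbols, defined from equality and abstraction as in the systems of Gallin and
Andrews. -/

/-- Truth: `λ x_t. x_t = λ x_t. x_t`. -/
def tru : Form C := eq (lam 0 Ty.t (var 0 Ty.t)) (lam 0 Ty.t (var 0 Ty.t))

/-- `∀ x_α. A`, i.e. `λ x_α. ⊤ = λ x_α. A`, where `x_α` is `var i α`. -/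
def all (i : ℕ) (α : Ty n) (A : Form C) : Form C := eq (lam i α tru) (lam i α A)

/-- Falsity: `∀ x_t. x_t`. -/
def fls : Form C := all 0 Ty.t (var 0 Ty.t)

/-- Negation: `⊥ = A`. -/
def neg (A : Form C) : Form C := eq fls A

/-- Conjunction as a closed term: `λ x_t. λ y_t. (λ g_ttt. g ⊤ ⊤) = (λ g_ttt. g x_t y_t)`. -/
def conjOp : Term C (Ty.fn Ty.t (Ty.fn Ty.t Ty.t)) :=
  lam 0 Ty.t (lam 1 Ty.t
    (eq (lam 0 (Ty.fn Ty.t (Ty.fn Ty.t Ty.t))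
          (app (app (var 0 (Ty.fn Ty.t (Ty.fn Ty.t Ty.t))) tru) tru))
        (lam 0 (Ty.fn Ty.t (Ty.fn Ty.t Ty.t))
          (app (app (var 0 (Ty.fn Ty.t (Ty.fn Ty.t Ty.t))) (var 0 Ty.t)) (var 1 Ty.t)))))

/-- Conjunction. -/
def conj (A B : Form C) : Form C := app (app conjOp A) B

/-- Disjunction: `¬ (¬ A ∧ ¬ B)`. -/
def disj (A B : Form C) : Form C := neg (conj (neg A) (neg B))

/-- Implication: `A = (A ∧ B)`. -/
def imp (A B : Form C) : Form C := eq A (conj A B)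

end Term

open Term

section Calculus

variable {n : ℕ} {C : Ty n → Type u}

/-- `Thm Ax φ`: the formula `φ` is a theorem of `Ty_n` with the non-logical axioms `Ax`. -/
inductive Thm (Ax : Set (Form C)) : Form C → Prop
  /-- non-logical axioms -/
  | nonlogical {φ : Form C} : φ ∈ Ax → Thm Ax φ
  /-- `(G ⊤ ∧ G ⊥) = ∀ x_t. G x_t` -/
  | truthValues (i : ℕ) (G : Term C (Ty.fn Ty.t Ty.t)) : ¬ Free i Ty.t G →
      Thm Ax (eq (conj (app G tru) (app G fls)) (all i Ty.t (app G (var i Ty.t))))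
  /-- `A = B → H A = H B` -/
  | leibniz {α : Ty n} (A B : Term C α) (H : Term C (Ty.fn α Ty.t)) :
      Thm Ax (imp (eq A B) (eq (app H A) (app H B)))
  /-- `(F = G) = ∀ x_α. F x_α = G x_α` -/
  | extensionality {α β : Ty n} (i : ℕ) (F G : Term C (Ty.fn α β)) :
      ¬ Free i α F → ¬ Free i α G →
      Thm Ax (eq (eq F G) (all i α (eq (app F (var i α)) (app G (var i α)))))
  /-- `(λ x_α. A) B = A(B)` -/
  | beta {α β : Ty n} (i : ℕ) (A : Term C β) (B : Term C α) : FreeFor i B A →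
      Thm Ax (eq (app (lam i α A) B) (subst i B A))
  /-- `ι (λ x_α. A = x_α) = A` -/
  | description {α : Ty n} (i : ℕ) (A : Term C α) : ¬ Free i α A →
      Thm Ax (eq (app (iota α) (lam i α (eq A (var i α)))) A)
  /-- `π₁ (A, B) = A` -/
  | fstPair {α β : Ty n} (A : Term C α) (B : Term C β) : Thm Ax (eq (fst (pair A B)) A)
  /-- `π₂ (A, B) = B` -/
  | sndPair {α β : Ty n} (A : Term C α) (B : Term C β) : Thm Ax (eq (snd (pair A B)) B)
  /-- `(π₁ A, π₂ A) = A` -/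
  | pairProj {α β : Ty n} (A : Term C (Ty.prod α β)) : Thm Ax (eq (pair (fst A) (snd A)) A)
  /-- The rule of inference: replacement of one occurrence of a term by a provably equal term. -/
  | replace {α : Ty n} {A B : Term C α} {φ ψ : Form C} :
      Thm Ax (eq A B) → Thm Ax φ → Replace A B φ ψ → Thm Ax ψ

/-- `Δ ⊢ φ` in the theory with the non-logical axioms `Ax`: for some `ψ₁, …, ψₖ ∈ Δ` the formula
`ψ₁ → … → ψₖ → φ` is a theorem. Members of `Δ` may have free variables, which are not generalized
in a derivation. -/
def Derives (Ax Δ : Set (Form C)) (φ : Form C) : Prop :=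
  ∃ l : List (Form C), (∀ ψ ∈ l, ψ ∈ Δ) ∧ Thm Ax (l.foldr imp φ)

/-- `Δ` is consistent in the theory with the non-logical axioms `Ax`. -/
def Consistent (Ax Δ : Set (Form C)) : Prop := ¬ Derives Ax Δ fls

end Calculus

section Symbolic

variable {n : ℕ} [NeZero n]

/-- The symbolic type `s`, the last individual type `e_n`. -/
abbrev symb (n : ℕ) [NeZero n] : Ty n := Ty.e ⟨n - 1, Nat.sub_lt (NeZero.pos n) Nat.one_pos⟩

/-- The non-logical constants of `Ty_n` over an alphabet of `N` symbols: concatenation, the empty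
word, one constant for each symbol, and arbitrary further constants `K`. -/
inductive SymConst (N : ℕ) (K : Ty n → Type u) : Ty n → Type u where
  | cat : SymConst N K (Ty.fn (symb n) (Ty.fn (symb n) (symb n)))
  | eps : SymConst N K (symb n)
  | letter (i : Fin N) : SymConst N K (symb n)
  | other {α : Ty n} (k : K α) : SymConst N K α

variable {N : ℕ} {K : Ty n → Type u}

/-- The empty-word constant. -/
def epsT : Term (SymConst N K) (symb n) := const SymConst.eps

/-- The constant of the `i`-th symbol of the alphabet. -/
def letterT (i : Fin N) : Term (SymConst N K) (symb n) := const (SymConst.letter i)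

/-- Concatenation `A + B` of terms of type `s`. -/
def catT (A B : Term (SymConst N K) (symb n)) : Term (SymConst N K) (symb n) :=
  app (app (const SymConst.cat) A) B

/-- The non-logical axioms that extend `Ty_n` to the theory of the symbolic type. -/
inductive SymAx (N : ℕ) (K : Ty n → Type u) : Form (SymConst N K) → Prop
  /-- `∀ x (x + ε = x ∧ ε + x = x)` -/
  | unit : SymAx N K (all 0 (symb n)
      (conj (eq (catT (var 0 _) epsT) (var 0 _)) (eq (catT epsT (var 0 _)) (var 0 _))))
  /-- `∀ x y z ((x + y) + z = x + (y + z))` -/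
  | assoc : SymAx N K (all 0 (symb n) (all 1 (symb n) (all 2 (symb n)
      (eq (catT (catT (var 0 _) (var 1 _)) (var 2 _))
          (catT (var 0 _) (catT (var 1 _) (var 2 _)))))))
  /-- `∀ x y z (x + aᵢ + y ≠ x + aⱼ + z)` for `i < j` -/
  | distinct (i j : Fin N) : i < j → SymAx N K (all 0 (symb n) (all 1 (symb n) (all 2 (symb n)
      (neg (eq (catT (catT (var 0 _) (letterT i)) (var 1 _))
               (catT (catT (var 0 _) (letterT j)) (var 2 _)))))))

/-- The set of the axioms of the symbolic type. -/
def symAxioms (N : ℕ) (K : Ty n → Type u) : Set (Form (SymConst N K)) := {φ | SymAx N K φ}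

/-- The term `T_A(w)` of type `s` that denotes the word `w`. -/
def wordT : List (Fin N) → Term (SymConst N K) (symb n)
  | [] => epsT
  | [a] => letterT a
  | a :: b :: w => catT (letterT a) (wordT (b :: w))

/-- An `α`-language: a relation between words over the alphabet and terms of type `α`. -/
abbrev Lang (N : ℕ) (K : Ty n → Type u) (α : Ty n) : Type u :=
  Set (List (Fin N) × Term (SymConst N K) α)

/-- Logically closed `α`-languages. -/
def LogicallyClosed {α : Ty n} (L : Lang N K α) : Prop :=
  ∀ (w : List (Fin N)) (A B D : Term (SymConst N K) α), (w, B) ∈ L → (w, D) ∈ L →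
    Thm (symAxioms N K) (disj (eq A B) (eq A D)) → (w, A) ∈ L

/-- The constants of an extension by additional non-logical constants `E`. -/
abbrev ExtConst (N : ℕ) (K : Ty n → Type u) (E : Ty n → Type v) : Ty n → Type (max u v) :=
  fun α => SymConst N K α ⊕ E α

/-- The inclusion of the terms into the terms of an extension. -/
def lift (E : Ty n → Type v) {α : Ty n} (A : Term (SymConst N K) α) : Term (ExtConst N K E) α :=
  A.map fun _ c => Sum.inl c

/-- The axioms of the symbolic type as formulas of an extension. -/
def extAxioms (N : ℕ) (K : Ty n → Type u) (E : Ty n → Type v) : Set (Form (ExtConst N K E)) :=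
  lift E '' symAxioms N K

/-- The language `L` is represented by `(Δ, R)`, with `Δ` a consistent set of formulas and `R` a
term of type `sαt` of the extension by the constants `E`. -/
def RepresentedBy (E : Ty n → Type v) {α : Ty n} (Δ : Set (Form (ExtConst N K E)))
    (R : Term (ExtConst N K E) (Ty.fn (symb n) (Ty.fn α Ty.t))) (L : Lang N K α) : Prop :=
  Consistent (extAxioms N K E) Δ ∧
    ∀ (w : List (Fin N)) (A : Term (SymConst N K) α),
      (w, A) ∈ L ↔ Derives (extAxioms N K E) Δ (app (app R (lift E (wordT w))) (lift E A))

/-- `Ty_n`-representable `α`-languages. -/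
def Representable {α : Ty n} (L : Lang N K α) : Prop :=
  ∃ (E : Ty n → Type v) (Δ : Set (Form (ExtConst N K E)))
    (R : Term (ExtConst N K E) (Ty.fn (symb n) (Ty.fn α Ty.t))), RepresentedBy E Δ R L

/-- The set of the formulas `c T_A(w) A` with `(w, A) ∈ L`, where `c` is an additional constant of
type `sαt`. -/
def langAxioms (E : Ty n → Type v) {α : Ty n} (c : E (Ty.fn (symb n) (Ty.fn α Ty.t)))
    (L : Lang N K α) : Set (Form (ExtConst N K E)) :=
  {φ | ∃ (w : List (Fin N)) (A : Term (SymConst N K) α), (w, A) ∈ L ∧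
    φ = app (app (const (Sum.inr c)) (lift E (wordT w))) (lift E A)}

end Symbolic

end TyN

/-! A representing pair forces logical closure because a provable `A = B ∨ A = D` yields, by two
instances of Leibniz's law and propositional logic, the implication from `R w B` and `R w D` to `R w
A`. This needs only that provability survives the enlargement of the language (`Thm.map`).

For the converse, consistency comes from a standard model: individuals are words, and every
additional constant denotes the function `Sem.top`, which for type `sαt` is constantly true. So all
formulas `c w A` hold at once.

The substantial point is that `c w A` is derivable only when `(w, A)` lies in the language. A
derivation uses finitely many hypotheses `c wᵢ Aᵢ`. As `c` occurs in no axiom, it can be replaced by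
an arbitrary term (`thm_foldr_imp_of_const`). Choose the finite graph `λx λy ⋁ᵢ (x = wᵢ ∧ y = Aᵢ)`
(`exists_graph`): the hypotheses become theorems, and the conclusion becomes `⋁ᵢ (w = wᵢ ∧ A = Aᵢ)`.
Distinct words are provably distinct when the alphabet is not a singleton (`thm_wordT_ne`), so `A =
Aᵢ` is left, as a disjunction over those `i` with `wᵢ = w`.

Logical closure speaks of two alternatives only. Description supplies a term `Z` that is `D` if `A =
B` and `A` otherwise; then `A` is `B` or `Z`, and `Z` has one alternative fewer, so induction
applies (`LogicallyClosed.mem_of_eqDisj`). The empty disjunction is excluded by consistency of the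
theory of words.

All of this rests on two general tools: every instance of a tautology is a theorem
(`PropForm.taut`), and constants may be replaced by sufficiently fresh terms throughout a derivation
(`Thm.csubst`). -/

namespace TyN

/-! ### Free variables, substitution and the defined logical symbols. -/

namespace Term

variable {n : ℕ} {C : Ty n → Type u}

/-- A strict upper bound for the indices of all free and bound variables of a term. -/
def varBound : {β : Ty n} → Term C β → ℕ
  | _, var i _ => i + 1
  | _, const _ => 0
  | _, iota _ => 0
  | _, app A B => max (varBound A) (varBound B)
  | _, lam i _ A => max (i + 1) (varBound A)
  | _, eq A B => max (varBound A) (varBound B)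
  | _, pair A B => max (varBound A) (varBound B)
  | _, fst A => varBound A
  | _, snd A => varBound A

theorem Free.lt_varBound {i : ℕ} {α β : Ty n} {A : Term C β} (h : Free i α A) :
    i < varBound A := by
  induction A with
  | var j γ => simp only [Free] at h; simp [varBound, h.1]
  | const c => exact h.elim
  | iota γ => exact h.elim
  | app A B ihA ihB => simp only [Free] at h; simp only [varBound]; grind
  | lam j γ A ih => simp only [Free] at h; simp only [varBound]; grind
  | eq A B ihA ihB => simp only [Free] at h; simp only [varBound]; grind
  | pair A B ihA ihB => simp only [Free] at h; simp only [varBound]; grind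
  | fst A ih => exact ih h
  | snd A ih => exact ih h

theorem not_free_of_varBound_le {i : ℕ} {α β : Ty n} {A : Term C β} (h : varBound A ≤ i) :
    ¬ Free i α A := fun hf => absurd hf.lt_varBound (not_lt.mpr h)

theorem subst_of_not_free {i : ℕ} {α β : Ty n} {B : Term C α} {A : Term C β}
    (h : ¬ Free i α A) : subst i B A = A := by
  induction A with
  | var j γ =>
    simp only [Free] at h
    simp only [subst]
    rw [dif_neg (fun hh => h ⟨hh.1, hh.2.symm⟩)]
  | const c => rfl
  | iota γ => rfl
  | app A B ihA ihB => simp only [Free, not_or] at h; simp [subst, ihA h.1, ihB h.2]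
  | lam j γ A ih =>
    simp only [Free] at h
    simp only [subst]
    split_ifs with hj
    · rfl
    · rw [ih (fun hf => h ⟨hj, hf⟩)]
  | eq A B ihA ihB => simp only [Free, not_or] at h; simp [subst, ihA h.1, ihB h.2]
  | pair A B ihA ihB => simp only [Free, not_or] at h; simp [subst, ihA h.1, ihB h.2]
  | fst A ih => simp only [subst, ih h]
  | snd A ih => simp only [subst, ih h]

theorem freeFor_of_not_free {i : ℕ} {α β : Ty n} {B : Term C α} {A : Term C β}
    (h : ¬ Free i α A) : FreeFor i B A := by
  induction A with
  | var j γ => trivial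
  | const c => trivial
  | iota γ => trivial
  | app A B ihA ihB => simp only [Free, not_or] at h; exact ⟨ihA h.1, ihB h.2⟩
  | lam j γ A ih => simp only [Free] at h; simp only [FreeFor]; tauto
  | eq A B ihA ihB => simp only [Free, not_or] at h; exact ⟨ihA h.1, ihB h.2⟩
  | pair A B ihA ihB => simp only [Free, not_or] at h; exact ⟨ihA h.1, ihB h.2⟩
  | fst A ih => exact ih h
  | snd A ih => exact ih h

theorem freeFor_of_closed {i : ℕ} {α β : Ty n} {B : Term C α} {A : Term C β}
    (h : ∀ j γ, ¬ Free j γ B) : FreeFor i B A := by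
  induction A with
  | var j γ => trivial
  | const c => trivial
  | iota γ => trivial
  | app A B ihA ihB => exact ⟨ihA, ihB⟩
  | lam j γ A ih => exact Or.inr (Or.inr ⟨h _ _, ih⟩)
  | eq A B ihA ihB => exact ⟨ihA, ihB⟩
  | pair A B ihA ihB => exact ⟨ihA, ihB⟩
  | fst A ih => exact ih
  | snd A ih => exact ih

theorem subst_var_self (i : ℕ) (α : Ty n) {β : Ty n} (A : Term C β) :
    subst i (var i α) A = A := by
  induction A with
  | var j γ =>
    simp only [subst]
    split_ifs with h
    · obtain ⟨rfl, rfl⟩ := h; rfl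
    · rfl
  | const c => rfl
  | iota γ => rfl
  | app A B ihA ihB => simp [subst, ihA, ihB]
  | lam j γ A ih => simp [subst, ih]
  | eq A B ihA ihB => simp [subst, ihA, ihB]
  | pair A B ihA ihB => simp [subst, ihA, ihB]
  | fst A ih => simp [subst, ih]
  | snd A ih => simp [subst, ih]

theorem freeFor_var_self (i : ℕ) (α : Ty n) {β : Ty n} (A : Term C β) :
    FreeFor i (var i α) A := by
  induction A with
  | var j γ => trivial
  | const c => trivial
  | iota γ => trivial
  | app A B ihA ihB => exact ⟨ihA, ihB⟩
  | lam j γ A ih =>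
    simp only [FreeFor, Free]
    by_cases h : j = i ∧ γ = α
    · exact Or.inl h
    · exact Or.inr (Or.inr ⟨fun hh => h ⟨hh.1.symm, hh.2.symm⟩, ih⟩)
  | eq A B ihA ihB => exact ⟨ihA, ihB⟩
  | pair A B ihA ihB => exact ⟨ihA, ihB⟩
  | fst A ih => exact ih
  | snd A ih => exact ih

section LogicalSymbols

variable (i : ℕ) {α : Ty n} (B : Term C α) (P Q : Form C)

theorem free_tru : ¬ Free i α (tru : Form C) := by simp [tru, Free]

theorem free_fls : ¬ Free i α (fls : Form C) := by simp [fls, all, tru, Free]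

theorem free_conjOp :
    ¬ Free i α (conjOp : Term C (Ty.fn Ty.t (Ty.fn Ty.t Ty.t))) := by
  simp only [conjOp, tru, Free]; grind

@[simp] theorem subst_tru : subst i B (tru : Form C) = tru := subst_of_not_free (free_tru i)

@[simp] theorem subst_fls : subst i B (fls : Form C) = fls := subst_of_not_free (free_fls i)

@[simp] theorem subst_conj : subst i B (conj P Q) = conj (subst i B P) (subst i B Q) := by
  simp [conj, subst, subst_of_not_free (free_conjOp i)]

@[simp] theorem subst_neg : subst i B (neg P) = neg (subst i B P) := by simp [neg, subst]

@[simp] theorem subst_disj : subst i B (disj P Q) = disj (subst i B P) (subst i B Q) := by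
  simp [disj]

@[simp] theorem subst_imp : subst i B (imp P Q) = imp (subst i B P) (subst i B Q) := by
  simp [imp, subst]

@[simp] theorem freeFor_tru : FreeFor i B (tru : Form C) := freeFor_of_not_free (free_tru i)

@[simp] theorem freeFor_fls : FreeFor i B (fls : Form C) := freeFor_of_not_free (free_fls i)

@[simp] theorem freeFor_conj : FreeFor i B (conj P Q) ↔ FreeFor i B P ∧ FreeFor i B Q := by
  simp [conj, FreeFor, freeFor_of_not_free (free_conjOp i)]

@[simp] theorem freeFor_neg : FreeFor i B (neg P) ↔ FreeFor i B P := by simp [neg, FreeFor]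

@[simp] theorem freeFor_disj : FreeFor i B (disj P Q) ↔ FreeFor i B P ∧ FreeFor i B Q := by
  simp [disj]

@[simp] theorem freeFor_imp : FreeFor i B (imp P Q) ↔ FreeFor i B P ∧ FreeFor i B Q := by
  simp only [imp, FreeFor, freeFor_conj]; tauto

end LogicalSymbols

end Term

open Term

/-! ### Equality, quantifier and truth-value rules derived from the axioms. -/

namespace Thm

variable {n : ℕ} {C : Ty n → Type u} {Ax : Set (Form C)}

/-- In the beta instance `(λx. x) A = A` the left side is replaced by means of that same equation.
-/
theorem refl {α : Ty n} (A : Term C α) : Thm Ax (eq A A) := by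
  have h : Thm Ax (eq (app (lam 0 α (var 0 α)) A) A) := by
    simpa [subst] using Thm.beta (Ax := Ax) 0 (var 0 α) A trivial
  exact replace h h (.eqL _ .here)

theorem symm {α : Ty n} {A B : Term C α} (h : Thm Ax (eq A B)) : Thm Ax (eq B A) :=
  replace h (refl A) (.eqL _ .here)

theorem trans {α : Ty n} {A B D : Term C α} (h : Thm Ax (eq A B)) (h' : Thm Ax (eq B D)) :
    Thm Ax (eq A D) :=
  replace h' h (.eqR _ .here)

theorem eqMp {A B : Form C} (h : Thm Ax (eq A B)) (hA : Thm Ax A) : Thm Ax B :=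
  replace h hA .here

theorem appCongr {α β : Ty n} {F G : Term C (Ty.fn α β)} {A B : Term C α}
    (h : Thm Ax (eq F G)) (h' : Thm Ax (eq A B)) : Thm Ax (eq (app F A) (app G B)) :=
  replace h' (replace h (refl (app F A)) (.eqR _ (.appL _ .here))) (.eqR _ (.appR _ .here))

theorem lamCongr (i : ℕ) (α : Ty n) {β : Ty n} {A B : Term C β} (h : Thm Ax (eq A B)) :
    Thm Ax (eq (lam i α A) (lam i α B)) :=
  replace h (refl (lam i α A)) (.eqR _ (.lam _ _ .here))

theorem eqCongr {α : Ty n} {A B A' B' : Term C α}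
    (h : Thm Ax (eq A A')) (h' : Thm Ax (eq B B')) : Thm Ax (eq (eq A B) (eq A' B')) :=
  replace h' (replace h (refl (eq A B)) (.eqR _ (.eqL _ .here))) (.eqR _ (.eqR _ .here))

theorem conjCongr {A B A' B' : Form C} (h : Thm Ax (eq A A')) (h' : Thm Ax (eq B B')) :
    Thm Ax (eq (conj A B) (conj A' B')) :=
  appCongr (appCongr (refl _) h) h'

theorem tru_intro : Thm Ax (tru : Form C) := refl _

/-- A universal formula is the equation `λx. ⊤ = λx. A`; both sides are applied to `B` and
beta-reduced. -/
theorem tru_eq_subst {i : ℕ} {α : Ty n} {A : Form C} {B : Term C α} (h : Thm Ax (all i α A))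
    (hB : FreeFor i B A) : Thm Ax (eq tru (subst i B A)) := by
  have h1 := beta (Ax := Ax) i tru B (freeFor_tru i B)
  rw [subst_tru] at h1
  exact (h1.symm.trans (appCongr h (refl B))).trans (beta i A B hB)

theorem inst {i : ℕ} {α : Ty n} {A : Form C} {B : Term C α} (h : Thm Ax (all i α A))
    (hB : FreeFor i B A) : Thm Ax (subst i B A) :=
  (tru_eq_subst h hB).eqMp tru_intro

/-- Extensionality turns the reflexive equation of the identity function into a universal formula,
which can be instantiated as an equation with `⊤`. -/
theorem tru_eq_refl {α : Ty n} (B : Term C α) : Thm Ax (eq tru (eq B B)) := by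
  have hF : ∀ j γ, ¬ Free j γ (lam 0 α (var 0 α) : Term C _) := by
    intro j γ; simp only [Free]; tauto
  have h := (extensionality (Ax := Ax) 0 (lam 0 α (var 0 α)) (lam 0 α (var 0 α))
    (hF _ _) (hF _ _)).eqMp (refl _)
  have h1 := tru_eq_subst (B := B) h (by simp [FreeFor])
  have h2 : Thm Ax (eq (app (lam 0 α (var 0 α)) B) B) := by
    simpa [subst] using Thm.beta (Ax := Ax) 0 (var 0 α) B trivial
  have h3 : Thm Ax (eq tru (eq (app (lam 0 α (var 0 α)) B) (app (lam 0 α (var 0 α)) B))) := by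
    simpa [subst] using h1
  exact h3.trans (eqCongr h2 h2)

theorem tru_eq_eq {α : Ty n} {A B : Term C α} (h : Thm Ax (eq A B)) :
    Thm Ax (eq tru (eq A B)) :=
  (tru_eq_refl A).trans (eqCongr (refl A) h)

/-- The truth-value axiom for `G = λx. A`, beta-reduced. It is the source of all case distinctions
on formulas. -/
theorem conj_subst_eq_all (i : ℕ) (A : Form C) :
    Thm Ax (eq (conj (subst i tru A) (subst i fls A)) (all i Ty.t A)) := by
  have h := truthValues (Ax := Ax) i (lam i Ty.t A) (by simp [Free])
  have hT := beta (Ax := Ax) i A (tru : Form C) (freeFor_of_closed fun j _ => free_tru j)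
  have hF := beta (Ax := Ax) i A (fls : Form C) (freeFor_of_closed fun j _ => free_fls j)
  have hx := beta (Ax := Ax) i A (var i Ty.t) (freeFor_var_self i Ty.t A)
  rw [subst_var_self] at hx
  exact ((conjCongr hT hF).symm.trans h).trans (eqCongr (refl _) (lamCongr _ _ hx))

theorem tru_conj_tru : Thm Ax (eq (conj tru tru) (tru : Form C)) := by
  have h := conj_subst_eq_all (Ax := Ax) 0 tru
  rw [subst_tru, subst_tru] at h
  exact h.trans (tru_eq_refl _).symm

/-- A provisional form of `conj_intro`: passing from a theorem `A` to `⊤ = A` needs `tru_eq`, whose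
proof already uses introduction of conjunctions. -/
theorem conj_of_tru_eq {A B : Form C} (hA : Thm Ax (eq tru A)) (hB : Thm Ax (eq tru B)) :
    Thm Ax (conj A B) :=
  (conjCongr hA hB).eqMp (tru_conj_tru.symm.eqMp tru_intro)

theorem tru_conj_fls : Thm Ax (eq (conj tru fls) (fls : Form C)) := by
  have h := conj_subst_eq_all (Ax := Ax) 0 (var 0 Ty.t)
  simp only [Term.subst, and_self, dite_true] at h
  exact h

theorem tru_conj (A : Form C) : Thm Ax (eq (conj tru A) A) := by
  have h := (conj_subst_eq_all (Ax := Ax) 0 (eq (conj tru (var 0 Ty.t)) (var 0 Ty.t))).eqMp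
    (by simpa [subst] using conj_of_tru_eq (tru_eq_eq tru_conj_tru) (tru_eq_eq tru_conj_fls))
  simpa [subst] using inst (B := A) h (by simp [FreeFor])

/-- Falsity is the equation of `λx. ⊤` and `λx. x`, so by extensionality it equals `∀x (⊤ = x)`. By
truth values this is `(⊤ = ⊤) ∧ (⊤ = ⊥)`, which reduces to `⊤ = ⊥`. -/
theorem tru_eq_fls : Thm Ax (eq (eq tru fls) (fls : Form C)) := by
  have h := extensionality (Ax := Ax) 0 (lam 0 Ty.t tru) (lam 0 Ty.t (var 0 Ty.t))
    (by simp [Free]) (by simp [Free])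
  have h1 := beta (Ax := Ax) 0 tru (var 0 Ty.t) (freeFor_tru _ _)
  have h2 := beta (Ax := Ax) 0 (var 0 Ty.t) (var 0 Ty.t) trivial
  rw [subst_var_self] at h2
  rw [subst_tru] at h1
  have h3 : Thm Ax (eq fls (all 0 Ty.t (eq tru (var 0 Ty.t)))) :=
    h.trans (eqCongr (refl _) (lamCongr _ _ (eqCongr h1 h2)))
  have h4 : Thm Ax (eq (conj (eq tru tru) (eq tru fls)) (all 0 Ty.t (eq tru (var 0 Ty.t)))) := by
    simpa [subst] using conj_subst_eq_all (Ax := Ax) 0 (eq tru (var 0 Ty.t))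
  have h5 := conjCongr (Ax := Ax) (tru_eq_refl tru) (refl (eq tru fls))
  exact (tru_conj _).symm.trans (h5.trans (h4.trans h3.symm))

theorem tru_eq (A : Form C) : Thm Ax (eq (eq tru A) A) := by
  have h := (conj_subst_eq_all (Ax := Ax) 0 (eq (eq tru (var 0 Ty.t)) (var 0 Ty.t))).eqMp
    (by
      simpa [subst] using conj_of_tru_eq (tru_eq_eq (tru_eq_refl tru).symm)
        (tru_eq_eq tru_eq_fls))
  simpa [subst] using inst (B := A) h (by simp [FreeFor])

theorem tru_eq_of {A : Form C} (h : Thm Ax A) : Thm Ax (eq tru A) := (tru_eq A).symm.eqMp h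

theorem conj_intro {A B : Form C} (hA : Thm Ax A) (hB : Thm Ax B) : Thm Ax (conj A B) :=
  conj_of_tru_eq hA.tru_eq_of hB.tru_eq_of

/-- The replacement rule acts in the scope of abstractions, so `⊤ = A` may be used under `λx`, with
no condition on the variable. -/
theorem gen (i : ℕ) (α : Ty n) {A : Form C} (h : Thm Ax A) : Thm Ax (all i α A) :=
  lamCongr i α h.tru_eq_of

/-- Substitution of a term for a free variable. -/
theorem subst {i : ℕ} {α : Ty n} {A : Form C} {B : Term C α} (h : Thm Ax A)
    (hB : FreeFor i B A) : Thm Ax (Term.subst i B A) :=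
  inst (gen i α h) hB

theorem mp {A B : Form C} (h : Thm Ax (imp A B)) (hA : Thm Ax A) : Thm Ax B :=
  ((conjCongr hA.tru_eq_of.symm (refl B)).trans (tru_conj B)).eqMp (eqMp h hA)

/-- Case distinction on a truth value. -/
theorem cases {i : ℕ} {A B : Form C} (hT : Thm Ax (Term.subst i tru A))
    (hF : Thm Ax (Term.subst i fls A)) (hB : FreeFor i B A) : Thm Ax (Term.subst i B A) :=
  inst ((conj_subst_eq_all i A).eqMp (conj_intro hT hF)) hB

/-- Leibniz's axiom for `λx. ⊤` and `λx. x` with `H = λf. f A` says `⊥ → (⊤ = A)`. Since implication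
is an equation with a conjunction, this reduces to `⊥ = (⊥ ∧ A)`. -/
theorem fls_conj (A : Form C) : Thm Ax (eq (conj fls A) fls) := by
  set m := varBound A
  have hm : ¬ Free m (Ty.fn Ty.t Ty.t) A := not_free_of_varBound_le le_rfl
  have h := leibniz (Ax := Ax) (lam 0 Ty.t tru) (lam 0 Ty.t (var 0 Ty.t))
    (lam m (Ty.fn Ty.t Ty.t) (app (var m (Ty.fn Ty.t Ty.t)) A))
  have hb : ∀ F : Term C (Ty.fn Ty.t Ty.t),
      Thm Ax (eq (app (lam m (Ty.fn Ty.t Ty.t) (app (var m (Ty.fn Ty.t Ty.t)) A)) F)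
        (app F A)) := by
    intro F
    simpa [Term.subst, subst_of_not_free hm] using
      beta (Ax := Ax) m (app (var m (Ty.fn Ty.t Ty.t)) A) F ⟨trivial, freeFor_of_not_free hm⟩
  have h1 := beta (Ax := Ax) 0 tru A (freeFor_tru _ _)
  have h2 : Thm Ax (eq (app (lam 0 Ty.t (var 0 Ty.t)) A) A) := by
    simpa [Term.subst] using beta (Ax := Ax) 0 (var 0 Ty.t) A trivial
  rw [subst_tru] at h1
  have h3 := (eqCongr ((hb _).trans h1) ((hb _).trans h2)).trans (tru_eq A)
  exact symm (trans h (conjCongr (refl _) h3))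

/-- Leibniz's axiom with `H = λx. (x = ⊥)` reduces to `(⊥ = ⊤) → ⊥`, that is, `(⊥ = ⊤) = ((⊥ = ⊤) ∧
⊥)`; a case distinction shows that any conjunction with `⊥` equals `⊥`. -/
theorem fls_eq_tru : Thm Ax (eq (eq fls tru) (fls : Form C)) := by
  have h := leibniz (Ax := Ax) fls tru (lam 0 Ty.t (eq (var 0 Ty.t) fls))
  have hb : ∀ F : Form C,
      Thm Ax (eq (app (lam 0 Ty.t (eq (var 0 Ty.t) fls)) F) (eq F fls)) := by
    intro F
    simpa [Term.subst] using
      beta (Ax := Ax) 0 (eq (var 0 Ty.t) fls) F ⟨trivial, freeFor_fls _ _⟩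
  have h1 := ((eqCongr ((hb _).trans (tru_eq_refl fls).symm) ((hb _).trans tru_eq_fls)).trans
    tru_eq_fls)
  have h2 : Thm Ax (eq (conj (eq fls tru) fls) (fls : Form C)) := by
    simpa [Term.subst] using cases (i := 0) (A := eq (conj (var 0 Ty.t) fls) fls)
      (B := eq fls tru) (by simpa [Term.subst] using tru_conj_fls)
      (by simpa [Term.subst] using fls_conj fls) (by simp [FreeFor])
  exact (trans h (conjCongr (refl _) h1)).trans h2

end Thm

/-! ### Completeness for propositional tautologies. -/

/-- Propositional formulas in `k` variables. -/
inductive PropForm (k : ℕ) : Type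
  | var (i : Fin k)
  | tru
  | fls
  | conj (p q : PropForm k)
  | iff (p q : PropForm k)

namespace PropForm

variable {k : ℕ}

/-- Negation. -/
abbrev neg (p : PropForm k) : PropForm k := iff fls p

/-- Disjunction. -/
abbrev disj (p q : PropForm k) : PropForm k := neg (conj (neg p) (neg q))

/-- Implication. -/
abbrev imp (p q : PropForm k) : PropForm k := iff p (conj p q)

/-- The truth value under a valuation. -/
def eval (v : Fin k → Bool) : PropForm k → Bool
  | var i => v i
  | tru => true
  | fls => false
  | conj p q => eval v p && eval v q
  | iff p q => eval v p == eval v q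

variable {n : ℕ} {C : Ty n → Type u}

/-- The formula of `Ty_n` that results from substituting formulas for the variables. -/
def toForm (σ : Fin k → Form C) : PropForm k → Form C
  | var i => σ i
  | tru => Term.tru
  | fls => Term.fls
  | conj p q => Term.conj (toForm σ p) (toForm σ q)
  | iff p q => Term.eq (toForm σ p) (toForm σ q)

/-- The formula that denotes a truth value. -/
def boolForm : Bool → Form C
  | true => Term.tru
  | false => Term.fls

theorem subst_toForm (i : ℕ) (B : Form C) (σ : Fin k → Form C) (p : PropForm k) :
    Term.subst i B (p.toForm σ) = p.toForm fun j => Term.subst i B (σ j) := by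
  induction p with
  | var j => rfl
  | tru => exact subst_tru _ _
  | fls => exact subst_fls _ _
  | conj p q ihp ihq => simp [toForm, ihp, ihq]
  | iff p q ihp ihq => simp [toForm, Term.subst, ihp, ihq]

theorem freeFor_toForm {i : ℕ} {B : Form C} {σ : Fin k → Form C}
    (h : ∀ j, FreeFor i B (σ j)) (p : PropForm k) : FreeFor i B (p.toForm σ) := by
  induction p with
  | var j => exact h j
  | tru => exact freeFor_tru _ _
  | fls => exact freeFor_fls _ _
  | conj p q ihp ihq => simp [toForm, ihp, ihq]
  | iff p q ihp ihq => exact ⟨ihp, ihq⟩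

theorem thm_eq_boolForm {Ax : Set (Form C)} (v : Fin k → Bool) (p : PropForm k) :
    Thm Ax (Term.eq (p.toForm fun j => boolForm (v j)) (boolForm (p.eval v))) := by
  induction p with
  | var j => exact Thm.refl _
  | tru => exact Thm.refl _
  | fls => exact Thm.refl _
  | conj p q ihp ihq =>
    refine (Thm.conjCongr ihp ihq).trans ?_
    simp only [eval]
    cases p.eval v
    · exact Thm.fls_conj _
    · exact Thm.tru_conj _
  | iff p q ihp ihq =>
    refine (Thm.eqCongr ihp ihq).trans ?_
    simp only [eval]
    cases p.eval v <;> cases q.eval v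
    · exact (Thm.tru_eq_refl _).symm
    · exact Thm.fls_eq_tru
    · exact Thm.tru_eq_fls
    · exact (Thm.tru_eq_refl _).symm

/-- Every instance of a tautology is a theorem. -/
theorem taut {Ax : Set (Form C)} (p : PropForm k) (σ : Fin k → Form C)
    (hp : ∀ v, p.eval v = true) : Thm Ax (p.toForm σ) := by
  -- The set `s` contains the positions that may still carry arbitrary formulas; each induction step
  -- settles one of them by a case distinction.
  suffices H : ∀ (s : Finset (Fin k)) (σ : Fin k → Form C),
      (∀ j ∉ s, ∃ b, σ j = boolForm b) → Thm Ax (p.toForm σ) from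
    H Finset.univ σ fun j hj => absurd (Finset.mem_univ j) hj
  intro s
  induction s using Finset.induction_on with
  | empty =>
    intro σ hσ
    choose v hv using fun j => hσ j (Finset.notMem_empty j)
    have h := thm_eq_boolForm (Ax := Ax) v p
    rw [hp v, ← funext hv] at h
    exact h.symm.eqMp Thm.tru_intro
  | insert a s ha ih =>
    intro σ hσ
    -- The variable with index `m` and type `t` is fresh for every `σ j`. It takes the place of `σ
    -- a`, so that `Thm.cases` applies to a single variable.
    set m := Finset.univ.sup fun j => varBound (σ j)
    have hm : ∀ j, ¬ Free m Ty.t (σ j) := fun j =>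
      not_free_of_varBound_le (Finset.le_sup (f := fun j => varBound (σ j)) (Finset.mem_univ j))
    have hs : ∀ B : Form C, Term.subst m B (p.toForm (Function.update σ a (Term.var m Ty.t)))
        = p.toForm (Function.update σ a B) := by
      intro B
      rw [subst_toForm]
      congr 1
      funext j
      by_cases hj : j = a
      · subst hj; simp [Term.subst]
      · simp [Function.update_of_ne hj, subst_of_not_free (hm j)]
    have hb : ∀ b, Thm Ax (p.toForm (Function.update σ a (boolForm b))) := by
      intro b
      refine ih _ fun j hj => ?_
      by_cases hja : j = a
      · subst hja; exact ⟨b, by simp⟩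
      · rw [Function.update_of_ne hja]
        exact hσ j (by simp [hja, hj])
    have h := Thm.cases (Ax := Ax) (i := m)
      (A := p.toForm (Function.update σ a (Term.var m Ty.t))) (B := σ a)
      (by rw [hs]; exact hb true) (by rw [hs]; exact hb false)
      (freeFor_toForm (fun j => by
        by_cases hj : j = a
        · subst hj; simp [FreeFor]
        · rw [Function.update_of_ne hj]; exact freeFor_of_not_free (hm j)) p)
    rwa [hs, Function.update_eq_self] at h

end PropForm

end TyN

namespace TyN

/-! ### Replacement of constants by terms in derivations. -/

namespace Term

variable {n : ℕ} {C : Ty n → Type u} {D : Ty n → Type v}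

/-- Replacement of the non-logical constants by terms. Bound variables are not renamed. -/
def csubst (σ : ∀ α : Ty n, C α → Term D α) : {β : Ty n} → Term C β → Term D β
  | _, var i α => var i α
  | _, const c => σ _ c
  | _, iota α => iota α
  | _, app A B => app (csubst σ A) (csubst σ B)
  | _, lam i α A => lam i α (csubst σ A)
  | _, eq A B => eq (csubst σ A) (csubst σ B)
  | _, pair A B => pair (csubst σ A) (csubst σ B)
  | _, fst A => fst (csubst σ A)
  | _, snd A => snd (csubst σ A)

theorem csubst_const {β : Ty n} (A : Term C β) : csubst (fun _ c => const c) A = A := by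
  induction A <;> simp_all [csubst]

theorem csubst_map {C' : Ty n → Type*} (f : ∀ α : Ty n, C' α → C α)
    (σ : ∀ α : Ty n, C α → Term D α) {β : Ty n} (A : Term C' β) :
    csubst σ (map f A) = csubst (fun _ c => σ _ (f _ c)) A := by
  induction A <;> simp_all [csubst, map]

theorem map_eq_csubst (f : ∀ α : Ty n, C α → D α) {β : Ty n} (A : Term C β) :
    map f A = csubst (fun _ c => const (f _ c)) A := by
  induction A <;> simp_all [csubst, map]

theorem Replace.csubst (σ : ∀ α : Ty n, C α → Term D α) {α β : Ty n} {A B : Term C α}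
    {P Q : Term C β} (h : Replace A B P Q) :
    Replace (A.csubst σ) (B.csubst σ) (P.csubst σ) (Q.csubst σ) := by
  induction h with
  | here => exact .here
  | appL _ _ ih => exact .appL _ ih
  | appR _ _ ih => exact .appR _ ih
  | lam _ _ _ ih => exact .lam _ _ ih
  | eqL _ _ ih => exact .eqL _ ih
  | eqR _ _ ih => exact .eqR _ ih
  | pairL _ _ ih => exact .pairL _ ih
  | pairR _ _ ih => exact .pairR _ ih
  | fst _ ih => exact .fst ih
  | snd _ ih => exact .snd ih

/-- `FreshAbove M σ`: all free variables of the terms `σ α c` have an index of at least `M`. -/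
def FreshAbove (M : ℕ) (σ : ∀ α : Ty n, C α → Term D α) : Prop :=
  ∀ (α : Ty n) (c : C α) (i : ℕ) (γ : Ty n), Free i γ (σ α c) → M ≤ i

theorem FreshAbove.mono {M M' : ℕ} (h : M' ≤ M) {σ : ∀ α : Ty n, C α → Term D α}
    (hσ : FreshAbove M σ) : FreshAbove M' σ :=
  fun α c i γ hf => h.trans (hσ α c i γ hf)

variable {M : ℕ} {σ : ∀ α : Ty n, C α → Term D α}

theorem free_csubst (hσ : FreshAbove M σ) {i : ℕ} (hi : i < M) {α β : Ty n} (A : Term C β) :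
    Free i α (csubst σ A) ↔ Free i α A := by
  induction A with
  | const c =>
    simp only [csubst, Free, iff_false]
    exact fun h => absurd (hσ _ c _ _ h) (not_le.mpr hi)
  | _ => simp_all [csubst, Free]

theorem csubst_subst (hσ : FreshAbove M σ) {i : ℕ} (hi : i < M) {α β : Ty n} (B : Term C α)
    (A : Term C β) : csubst σ (subst i B A) = subst i (csubst σ B) (csubst σ A) := by
  induction A with
  | const c =>
    simp only [csubst, subst]
    rw [subst_of_not_free fun h => absurd (hσ _ c _ _ h) (not_le.mpr hi)]
  | var j γ =>
    simp only [csubst, subst]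
    split_ifs with h
    · obtain ⟨rfl, rfl⟩ := h; rfl
    · rfl
  | lam j γ A ih =>
    simp only [csubst, subst]
    split_ifs with h
    · rfl
    · simp only [csubst, ih]
  | _ => simp_all [csubst, subst]

/-- Bounding `varBound A` by `M` covers the bound variables of `A` too, so no abstraction in `A` can
capture a variable that `σ` brings into `B`. -/
theorem FreeFor.csubst (hσ : FreshAbove M σ) {i : ℕ} (hi : i < M) {α β : Ty n} {B : Term C α}
    {A : Term C β} (hA : varBound A ≤ M) (h : FreeFor i B A) :
    FreeFor i (csubst σ B) (csubst σ A) := by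
  induction A with
  | const c =>
    exact freeFor_of_not_free fun h => absurd (hσ _ c _ _ h) (not_le.mpr hi)
  | var j γ => trivial
  | iota γ => trivial
  | lam j γ A ih =>
    simp only [varBound, max_le_iff] at hA
    simp only [Term.csubst, FreeFor, free_csubst hσ hi, free_csubst hσ (Nat.lt_of_succ_le hA.1)]
    rcases h with h | h | h
    · exact Or.inl h
    · exact Or.inr (Or.inl h)
    · exact Or.inr (Or.inr ⟨h.1, ih hA.2 h.2⟩)
  | app A A' ihA ihB =>
    simp only [varBound, max_le_iff] at hA; exact ⟨ihA hA.1 h.1, ihB hA.2 h.2⟩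
  | eq A A' ihA ihB =>
    simp only [varBound, max_le_iff] at hA; exact ⟨ihA hA.1 h.1, ihB hA.2 h.2⟩
  | pair A A' ihA ihB =>
    simp only [varBound, max_le_iff] at hA; exact ⟨ihA hA.1 h.1, ihB hA.2 h.2⟩
  | fst A ih => exact ih hA h
  | snd A ih => exact ih hA h

end Term

open Term

variable {n : ℕ} {C : Ty n → Type u} {D : Ty n → Type v}

/-- A theorem stays a theorem when the constants are replaced by terms whose free variables have
large indices. -/
theorem Thm.csubst {Ax : Set (Form C)} {φ : Form C} (h : Thm Ax φ) :
    -- The bound depends on the derivation alone, so `σ` can be chosen after it.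
    ∃ M : ℕ, ∀ (Ax' : Set (Form D)) (σ : ∀ α : Ty n, C α → Term D α), FreshAbove M σ →
      (∀ ψ ∈ Ax, Thm Ax' (ψ.csubst σ)) → Thm Ax' (φ.csubst σ) := by
  induction h with
  | nonlogical h => exact ⟨0, fun _ σ _ hAx => hAx _ h⟩
  | truthValues i G hG =>
    exact ⟨i + 1, fun _ σ hσ _ =>
      .truthValues i _ (by rwa [free_csubst hσ (Nat.lt_succ_self i)])⟩
  | leibniz A B H => exact ⟨0, fun _ σ _ _ => .leibniz _ _ _⟩
  | extensionality i F G hF hG =>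
    exact ⟨i + 1, fun _ σ hσ _ =>
      .extensionality i _ _ (by rwa [free_csubst hσ (Nat.lt_succ_self i)])
        (by rwa [free_csubst hσ (Nat.lt_succ_self i)])⟩
  | beta i A B hB =>
    refine ⟨max (i + 1) (varBound A), fun _ σ hσ _ => ?_⟩
    have hi : i < max (i + 1) (varBound A) := lt_max_of_lt_left (Nat.lt_succ_self i)
    simp only [Term.csubst]
    rw [csubst_subst hσ hi]
    exact .beta i _ _ (hB.csubst hσ hi (le_max_right _ _))
  | description i A hA =>
    exact ⟨i + 1, fun _ σ hσ _ =>
      .description i _ (by rwa [free_csubst hσ (Nat.lt_succ_self i)])⟩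
  | fstPair A B => exact ⟨0, fun _ σ _ _ => .fstPair _ _⟩
  | sndPair A B => exact ⟨0, fun _ σ _ _ => .sndPair _ _⟩
  | pairProj A => exact ⟨0, fun _ σ _ _ => .pairProj _⟩
  | replace _ _ hr ih ih' =>
    obtain ⟨M, hM⟩ := ih
    obtain ⟨M', hM'⟩ := ih'
    exact ⟨max M M', fun Ax' σ hσ hAx =>
      .replace (hM Ax' σ (hσ.mono (le_max_left _ _)) hAx)
        (hM' Ax' σ (hσ.mono (le_max_right _ _)) hAx) (hr.csubst σ)⟩

/-- Theorems are preserved by renaming of the constants. -/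
theorem Thm.map {Ax : Set (Form C)} {φ : Form C} (h : Thm Ax φ) (f : ∀ α : Ty n, C α → D α) :
    Thm (Term.map f '' Ax) (φ.map f) := by
  obtain ⟨M, hM⟩ := h.csubst (D := D)
  rw [map_eq_csubst]
  refine hM _ _ (fun _ _ _ _ hf => hf.elim) fun ψ hψ => ?_
  rw [← map_eq_csubst]
  exact .nonlogical ⟨ψ, hψ, rfl⟩

end TyN

namespace TyN

open Term

/-! ### Standard models and soundness. -/

section Semantics

variable {n : ℕ}

/-- The standard frame in which every individual type denotes the set `X`. -/
def Sem (X : Type) : Ty n → Type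
  | Ty.t => Prop
  | Ty.e _ => X
  | Ty.fn α β => Sem X α → Sem X β
  | Ty.prod α β => Sem X α × Sem X β

instance Sem.nonempty (X : Type) [Nonempty X] : ∀ α : Ty n, Nonempty (Sem X α)
  | Ty.t => ⟨True⟩
  | Ty.e _ => inferInstanceAs (Nonempty X)
  | Ty.fn _ β => ⟨fun _ => (Sem.nonempty X β).some⟩
  | Ty.prod α β => ⟨((Sem.nonempty X α).some, (Sem.nonempty X β).some)⟩

variable {C : Ty n → Type u} {X : Type} [Nonempty X]

/-- The denotation of a term in the standard model given by the interpretation `I` of the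
constants, under an assignment of the variables. -/
noncomputable def denote (I : ∀ α : Ty n, C α → Sem X α) :
    {β : Ty n} → Term C β → (∀ p : ℕ × Ty n, Sem X p.2) → Sem X β
  | _, var i α, ρ => ρ (i, α)
  | _, const c, _ => I _ c
  | _, iota α, _ => fun P : Sem X α → Prop => Classical.epsilon P
  | _, app A B, ρ => denote I A ρ (denote I B ρ)
  | _, lam i α A, ρ => fun x => denote I A (Function.update ρ (i, α) x)
  | _, eq A B, ρ => denote I A ρ = denote I B ρ
  | _, pair A B, ρ => (denote I A ρ, denote I B ρ)
  | _, fst A, ρ => (denote I A ρ).1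
  | _, snd A, ρ => (denote I A ρ).2

variable {I : ∀ α : Ty n, C α → Sem X α}

theorem denote_congr {β : Ty n} (A : Term C β) (ρ ρ' : ∀ p : ℕ × Ty n, Sem X p.2)
    (h : ∀ i α, Free i α A → ρ (i, α) = ρ' (i, α)) : denote I A ρ = denote I A ρ' := by
  induction A generalizing ρ ρ' with
  | var j γ => exact h j γ ⟨rfl, rfl⟩
  | const c => rfl
  | iota γ => rfl
  | app A B ihA ihB =>
    simp only [denote]
    rw [ihA ρ ρ' fun i α hf => h i α (Or.inl hf), ihB ρ ρ' fun i α hf => h i α (Or.inr hf)]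
  | lam j γ A ih =>
    simp only [denote]
    funext x
    refine ih _ _ fun i α hf => ?_
    by_cases hj : (i, α) = (j, γ)
    · cases hj; simp
    · rw [Function.update_of_ne hj, Function.update_of_ne hj]
      exact h i α ⟨fun hh => hj (by rw [hh.1, hh.2]), hf⟩
  | eq A B ihA ihB =>
    simp only [denote]
    rw [ihA ρ ρ' fun i α hf => h i α (Or.inl hf), ihB ρ ρ' fun i α hf => h i α (Or.inr hf)]
  | pair A B ihA ihB =>
    simp only [denote]
    rw [ihA ρ ρ' fun i α hf => h i α (Or.inl hf), ihB ρ ρ' fun i α hf => h i α (Or.inr hf)]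
  | fst A ih => simp only [denote]; rw [ih ρ ρ' h]
  | snd A ih => simp only [denote]; rw [ih ρ ρ' h]

theorem denote_update {i : ℕ} {α β : Ty n} {A : Term C β} (h : ¬ Free i α A)
    (ρ : ∀ p : ℕ × Ty n, Sem X p.2) (x : Sem X α) :
    denote I A (Function.update ρ (i, α) x) = denote I A ρ := by
  refine denote_congr _ _ _ fun j γ hf => Function.update_of_ne (fun hh => h ?_) _ _
  cases hh
  exact hf

theorem denote_subst {i : ℕ} {α β : Ty n} (B : Term C α) (A : Term C β) (h : FreeFor i B A)
    (ρ : ∀ p : ℕ × Ty n, Sem X p.2) :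
    denote I (subst i B A) ρ = denote I A (Function.update ρ (i, α) (denote I B ρ)) := by
  induction A generalizing ρ with
  | var j γ =>
    simp only [subst]
    split_ifs with hj
    · obtain ⟨rfl, rfl⟩ := hj; simp [denote]
    · simp only [denote]
      rw [Function.update_of_ne fun hh => hj ?_]
      cases hh; exact ⟨rfl, rfl⟩
  | const c => rfl
  | iota γ => rfl
  | app A A' ihA ihB => simp only [subst, denote]; rw [ihA h.1, ihB h.2]
  | lam j γ A ih =>
    by_cases hA : Free i α (lam j γ A)
    · have hj : ¬ (j = i ∧ γ = α) := hA.1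
      obtain ⟨hB, hf⟩ := (h.resolve_left hj).resolve_left (not_not.mpr hA.2)
      simp only [subst, if_neg hj, denote]
      funext x
      rw [ih hf, denote_update hB, Function.update_comm]
      intro hh
      cases hh; exact hj ⟨rfl, rfl⟩
    · rw [subst_of_not_free hA, denote_update hA]
  | eq A A' ihA ihB => simp only [subst, denote]; rw [ihA h.1, ihB h.2]
  | pair A A' ihA ihB => simp only [subst, denote]; rw [ihA h.1, ihB h.2]
  | fst A ih => simp only [subst, denote]; rw [ih h]
  | snd A ih => simp only [subst, denote]; rw [ih h]

theorem denote_replace {α β : Ty n} {A B : Term C α} {P Q : Term C β} (h : Replace A B P Q)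
    (hAB : ∀ ρ, denote I A ρ = denote I B ρ) (ρ : ∀ p : ℕ × Ty n, Sem X p.2) :
    denote I P ρ = denote I Q ρ := by
  induction h generalizing ρ with
  | here => exact hAB ρ
  | lam _ _ _ ih => simp only [denote]; funext x; exact ih _
  | _ => rename_i ih; simp only [denote]; rw [ih ρ]

theorem denote_tru (ρ : ∀ p : ℕ × Ty n, Sem X p.2) : denote I (tru : Form C) ρ = True :=
  eq_true rfl

theorem denote_all (i : ℕ) (α : Ty n) (A : Form C) (ρ : ∀ p : ℕ × Ty n, Sem X p.2) :
    denote I (all i α A) ρ = ∀ x, denote I A (Function.update ρ (i, α) x) := by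
  simp only [all, denote, denote_tru]
  refine propext ⟨fun h x => ?_, fun h => ?_⟩
  · rw [← congrFun h x]; trivial
  · funext x; exact (eq_true (h x)).symm

theorem denote_fls (ρ : ∀ p : ℕ × Ty n, Sem X p.2) : denote I (fls : Form C) ρ = False := by
  rw [fls, denote_all]
  refine eq_false fun h => ?_
  exact Eq.mp (Function.update_self (0, Ty.t) _ ρ) (h False)

theorem denote_neg (A : Form C) (ρ : ∀ p : ℕ × Ty n, Sem X p.2) :
    denote I (neg A) ρ = ¬ denote I A ρ := by
  simp only [neg, denote, denote_fls]
  exact propext ⟨fun h hA => h.mpr hA, fun h => (eq_false h).symm⟩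

theorem denote_conj (A B : Form C) (ρ : ∀ p : ℕ × Ty n, Sem X p.2) :
    denote I (conj A B) ρ = (denote I A ρ ∧ denote I B ρ) := by
  have h : denote I (conj A B) ρ = ((fun g : Prop → Prop → Prop => g True True) =
      fun g => g (denote I A ρ) (denote I B ρ)) := by
    simp only [conj, conjOp, denote, denote_tru, Function.update_self]
    congr 1
  rw [h]
  refine propext ⟨fun h => ?_, fun h => ?_⟩
  -- Evaluating both functionals at `And` recovers the two conjuncts.
  · exact (congrFun h And).mp ⟨trivial, trivial⟩
  · funext g
    rw [eq_true h.1, eq_true h.2]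

theorem denote_imp (A B : Form C) (ρ : ∀ p : ℕ × Ty n, Sem X p.2) :
    denote I (imp A B) ρ = (denote I A ρ → denote I B ρ) := by
  have h : denote I (imp A B) ρ = (denote I A ρ = (denote I A ρ ∧ denote I B ρ)) :=
    congrArg (denote I A ρ = ·) (denote_conj A B ρ)
  rw [h]
  exact propext ⟨fun h hA => (h.mp hA).2,
    fun h => propext ⟨fun hA => ⟨hA, h hA⟩, fun hh => hh.1⟩⟩

/-- Soundness of the calculus for standard models. -/
theorem Thm.sound {Ax : Set (Form C)} (hAx : ∀ ψ ∈ Ax, ∀ ρ, denote I ψ ρ) {φ : Form C}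
    (h : Thm Ax φ) : ∀ ρ, denote I φ ρ := by
  induction h with
  | nonlogical h => exact hAx _ h
  | truthValues i G hG =>
    intro ρ
    simp only [denote]
    rw [denote_conj, denote_all]
    simp only [denote, denote_tru, denote_fls, Function.update_self]
    simp only [denote_update hG]
    refine propext ⟨fun h (x : Prop) => ?_, fun h => ⟨h True, h False⟩⟩
    by_cases hx : x
    · rw [eq_true hx]; exact h.1
    · rw [eq_false hx]; exact h.2
  | leibniz A B H =>
    intro ρ
    rw [denote_imp]
    intro h
    simp only [denote] at h ⊢
    rw [h]
  | extensionality i F G hF hG =>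
    intro ρ
    simp only [denote]
    rw [denote_all]
    simp only [denote, Function.update_self, denote_update hF, denote_update hG]
    exact propext funext_iff
  | beta i A B hB =>
    intro ρ
    simp only [denote]
    rw [denote_subst B A hB]
  | description i A hA =>
    intro ρ
    simp only [denote, Function.update_self, denote_update hA]
    -- The predicate has a witness, hence the chosen element satisfies it, which says that it is the
    -- value of `A`.
    exact (Classical.epsilon_spec (p := fun x => denote I A ρ = x) ⟨_, rfl⟩).symm
  | fstPair A B => intro ρ; rfl
  | sndPair A B => intro ρ; rfl
  | pairProj A => intro ρ; rfl
  | replace _ _ hr ih ih' =>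
    intro ρ
    rw [← denote_replace hr ih]
    exact ih' ρ

theorem denote_map {D : Ty n → Type v} (f : ∀ α : Ty n, C α → D α)
    (J : ∀ α : Ty n, D α → Sem X α) {β : Ty n} (A : Term C β)
    (ρ : ∀ p : ℕ × Ty n, Sem X p.2) :
    denote J (map f A) ρ = denote (fun _ c => J _ (f _ c)) A ρ := by
  induction A generalizing ρ with
  | var j γ => rfl
  | const c => rfl
  | iota γ => rfl
  | app A B ihA ihB => simp only [map, denote]; rw [ihA, ihB]
  | lam j γ A ih => simp only [map, denote]; funext x; exact ih _
  | eq A B ihA ihB => simp only [map, denote]; rw [ihA, ihB]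
  | pair A B ihA ihB => simp only [map, denote]; rw [ihA, ihB]
  | fst A ih => simp only [map, denote]; rw [ih]
  | snd A ih => simp only [map, denote]; rw [ih]

/-- An element of each type; in `α → t` types it is the constantly true function. -/
noncomputable def Sem.top (X : Type) [Nonempty X] : ∀ α : Ty n, Sem X α
  | Ty.t => True
  | Ty.e _ => (Classical.arbitrary X : X)
  | Ty.fn _ β => fun _ => Sem.top X β
  | Ty.prod α β => (Sem.top X α, Sem.top X β)

end Semantics

/-! ### The model of words, and consistency. -/

section SymbolicModel

variable {n : ℕ} [NeZero n] {N : ℕ} {K : Ty n → Type u}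

/-- The interpretation of the constants of the symbolic type by words. -/
noncomputable def symInterp : ∀ α : Ty n, SymConst N K α → Sem (List (Fin N)) α
  | _, .cat => fun x y : List (Fin N) => x ++ y
  | _, .eps => ([] : List (Fin N))
  | _, .letter i => [i]
  | _, .other _ => Sem.top _ _

theorem symAxioms_valid {ψ : Form (SymConst N K)} (h : ψ ∈ symAxioms N K)
    (ρ : ∀ p : ℕ × Ty n, Sem (List (Fin N)) p.2) : denote symInterp ψ ρ := by
  cases h with
  | unit =>
    rw [denote_all]
    intro (x : List (Fin N))
    rw [denote_conj]
    exact ⟨List.append_nil _, rfl⟩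
  | assoc =>
    rw [denote_all]
    intro (x : List (Fin N))
    rw [denote_all]
    intro (y : List (Fin N))
    rw [denote_all]
    intro (z : List (Fin N))
    exact List.append_assoc _ _ _
  | distinct i j hij =>
    rw [denote_all]
    intro (x : List (Fin N))
    rw [denote_all]
    intro (y : List (Fin N))
    rw [denote_all]
    intro (z : List (Fin N))
    rw [denote_neg]
    -- The disequation holds under every assignment; a general one spares the unfolding of three
    -- nested updates.
    refine (?_ : ∀ ρ' : ∀ p : ℕ × Ty n, Sem (List (Fin N)) p.2,
      ¬ denote symInterp (_ : Form _) ρ') _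
    intro ρ'
    let val (k : ℕ) : List (Fin N) := ρ' (k, symb n)
    intro (h : (val 0 ++ [i]) ++ val 1 = (val 0 ++ [j]) ++ val 2)
    simp only [List.append_assoc, List.append_cancel_left_eq, List.cons_append,
      List.cons.injEq] at h
    exact hij.ne h.1

/-- The theory of the symbolic type is consistent. -/
theorem not_thm_fls : ¬ Thm (symAxioms N K) fls := by
  intro h
  have h1 := h.sound (fun _ hψ => symAxioms_valid hψ) fun p => Sem.top _ p.2
  rwa [denote_fls] at h1

/-- With the additional constants interpreted by `Sem.top`, the formulas of `langAxioms` are true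
whatever the language and the assignment, while `⊥` is false. -/
theorem consistent_langAxioms (E : Ty n → Type v) {α : Ty n}
    (c : E (Ty.fn (symb n) (Ty.fn α Ty.t))) (L : Lang N K α) :
    Consistent (extAxioms N K E) (langAxioms E c L) := by
  rintro ⟨l, hl, h⟩
  let I : ∀ α : Ty n, ExtConst N K E α → Sem (List (Fin N)) α :=
    fun _ => Sum.elim (symInterp _) fun _ => Sem.top _ _
  have h1 := h.sound (I := I) (by
    rintro _ ⟨ψ, hψ, rfl⟩ ρ
    rw [lift, denote_map]
    exact symAxioms_valid hψ ρ) fun p => Sem.top _ p.2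
  clear h
  induction l with
  | nil =>
    simp only [List.foldr_nil] at h1
    rwa [denote_fls] at h1
  | cons ψ l ih =>
    simp only [List.foldr_cons] at h1
    rw [denote_imp] at h1
    refine ih (fun φ hφ => hl φ (List.mem_cons_of_mem _ hφ)) (h1 ?_)
    obtain ⟨w, A, -, rfl⟩ := hl ψ List.mem_cons_self
    exact trivial

end SymbolicModel

end TyN

namespace TyN

open Term

/-! ### Leibniz's law, definition by cases and derivations from hypotheses. -/

section Derived

variable {n : ℕ} {C : Ty n → Type u} {Ax : Set (Form C)}

theorem Thm.conj_left {P Q : Form C} (h : Thm Ax (conj P Q)) : Thm Ax P :=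
  mp (PropForm.taut (.imp (.conj (.var 0) (.var 1)) (.var 0)) ![P, Q] (by decide)) h

theorem Thm.conj_right {P Q : Form C} (h : Thm Ax (conj P Q)) : Thm Ax Q :=
  mp (PropForm.taut (.imp (.conj (.var 0) (.var 1)) (.var 1)) ![P, Q] (by decide)) h

/-- Leibniz's axiom for `H = λx. P`, beta-reduced on both sides. -/
theorem Thm.leibniz_subst {α : Ty n} (i : ℕ) {A B : Term C α} {P : Form C}
    (hA : FreeFor i A P) (hB : FreeFor i B P) :
    Thm Ax (imp (eq A B) (eq (Term.subst i A P) (Term.subst i B P))) := by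
  have h := eqCongr (beta (Ax := Ax) i P A hA) (beta i P B hB)
  exact (eqCongr (refl _) (conjCongr (refl _) h)).eqMp (leibniz A B (lam i α P))

theorem Thm.eq_symm_imp {α : Ty n} (A B : Term C α) : Thm Ax (imp (eq A B) (eq B A)) := by
  set m := varBound A
  have hm : ¬ Free m α A := not_free_of_varBound_le le_rfl
  have h := leibniz_subst (Ax := Ax) m (A := A) (B := B) (P := eq (var m α) A)
    ⟨trivial, freeFor_of_not_free hm⟩ ⟨trivial, freeFor_of_not_free hm⟩
  simp only [Term.subst, and_self, dite_true, subst_of_not_free hm] at h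
  exact mp (mp (PropForm.taut (.imp (.imp (.var 0) (.iff (.var 1) (.var 2)))
    (.imp (.var 1) (.imp (.var 0) (.var 2)))) ![eq A B, eq A A, eq B A] (by decide)) h) (refl A)

/-- Definition by cases by means of the description operator. -/
theorem exists_ite {α : Ty n} (P : Form C) (X Y : Term C α) :
    ∃ Z : Term C α, Thm Ax (imp P (eq Z X)) ∧ Thm Ax (imp (neg P) (eq Z Y)) := by
  obtain ⟨i, hP, hX, hY⟩ : ∃ i, varBound P ≤ i ∧ varBound X ≤ i ∧ varBound Y ≤ i :=
    ⟨max (varBound P) (max (varBound X) (varBound Y)), by simp, by simp, by simp⟩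
  -- For `Q = ⊤` or `Q = ⊥` the described property collapses to `X = x` or `Y = x`, where the
  -- description axiom applies. The passage to `P` is by Leibniz's law at the variable `i + 1` of
  -- type `t`, fresh for `X` and `Y` and distinct from `i` even when `α = t`.
  let F : Form C → Term C α := fun Q => app (iota α) (lam i α
    (disj (conj Q (eq X (var i α))) (conj (neg Q) (eq Y (var i α)))))
  have hT : Thm Ax (eq (F tru) X) :=
    (Thm.appCongr (.refl _) (Thm.lamCongr _ _ (PropForm.taut
      (.iff (.disj (.conj .tru (.var 0)) (.conj (.neg .tru) (.var 1))) (.var 0))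
      ![eq X (var i α), eq Y (var i α)] (by decide)))).trans
      (.description i X (not_free_of_varBound_le hX))
  have hF : Thm Ax (eq (F fls) Y) :=
    (Thm.appCongr (.refl _) (Thm.lamCongr _ _ (PropForm.taut
      (.iff (.disj (.conj .fls (.var 0)) (.conj (.neg .fls) (.var 1))) (.var 1))
      ![eq X (var i α), eq Y (var i α)] (by decide)))).trans
      (.description i Y (not_free_of_varBound_le hY))
  have hjX : ¬ Free (i + 1) Ty.t X := not_free_of_varBound_le (hX.trans (Nat.le_succ i))
  have hjY : ¬ Free (i + 1) Ty.t Y := not_free_of_varBound_le (hY.trans (Nat.le_succ i))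
  have hs : ∀ Q : Form C, subst (i + 1) Q (F (var (i + 1) Ty.t)) = F Q := by
    intro Q
    simp [F, subst, subst_of_not_free hjX, subst_of_not_free hjY]
  have hf : ∀ Q : Form C, ¬ Free i α Q → FreeFor (i + 1) Q (F (var (i + 1) Ty.t)) := by
    intro Q hQ
    simp [F, FreeFor, freeFor_of_not_free hjX, freeFor_of_not_free hjY, hQ]
  have key : ∀ (Q : Form C) (V : Term C α), ¬ Free i α Q → ¬ Free (i + 1) Ty.t V →
      Thm Ax (eq (F Q) V) → Thm Ax (imp (eq Q P) (eq (F P) V)) := by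
    intro Q V hQ hV h
    have hfV : ∀ Q : Form C, ¬ Free i α Q →
        FreeFor (i + 1) Q (eq (F (var (i + 1) Ty.t)) V) := by
      intro Q hQ
      simp only [FreeFor]
      exact ⟨hf Q hQ, freeFor_of_not_free hV⟩
    have h1 := Thm.leibniz_subst (Ax := Ax) (i + 1) (hfV Q hQ)
      (hfV P (not_free_of_varBound_le hP))
    simp only [subst, hs, subst_of_not_free hV] at h1
    exact .mp (.mp (PropForm.taut (.imp (.imp (.var 0) (.iff (.var 1) (.var 2)))
      (.imp (.var 1) (.imp (.var 0) (.var 2)))) ![eq Q P, eq (F Q) V, eq (F P) V] (by decide))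
      h1) h
  -- Negation is by definition `⊥ = P`, so only the positive case has to be rewritten, from `⊤ = P`
  -- to `P`.
  exact ⟨F P, (Thm.eqCongr (Thm.tru_eq P) (Thm.conjCongr (Thm.tru_eq P) (.refl _))).eqMp
    (key tru X (free_tru i) hjX hT), key fls Y (free_fls i) hjY hF⟩

theorem thm_foldr_imp_mono (φ ψ : Form C) (l : List (Form C)) :
    Thm Ax (imp (imp φ ψ) (imp (l.foldr imp φ) (l.foldr imp ψ))) := by
  induction l with
  | nil => exact PropForm.taut (.imp (.var 0) (.var 0)) ![imp φ ψ] (by decide)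
  | cons χ l ih =>
    exact .mp (PropForm.taut (.imp (.imp (.var 0) (.imp (.var 1) (.var 2)))
      (.imp (.var 0) (.imp (.imp (.var 3) (.var 1)) (.imp (.var 3) (.var 2)))))
      ![imp φ ψ, l.foldr imp φ, l.foldr imp ψ, χ] (by decide)) ih

theorem Thm.of_foldr_imp {φ : Form C} {l : List (Form C)} (hl : ∀ ψ ∈ l, Thm Ax ψ)
    (h : Thm Ax (l.foldr imp φ)) : Thm Ax φ := by
  induction l with
  | nil => exact h
  | cons χ l ih =>
    exact ih (fun ψ hψ => hl ψ (List.mem_cons_of_mem _ hψ)) (h.mp (hl χ List.mem_cons_self))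

/-- The two lists of hypotheses are concatenated, and each chain of implications is treated as
monotone in its conclusion. -/
theorem Derives.mp₂ {Δ : Set (Form C)} {φ ψ χ : Form C} (h : Thm Ax (imp φ (imp ψ χ)))
    (hφ : Derives Ax Δ φ) (hψ : Derives Ax Δ ψ) : Derives Ax Δ χ := by
  obtain ⟨l, hl, h1⟩ := hφ
  obtain ⟨l', hl', h2⟩ := hψ
  refine ⟨l ++ l', fun θ hθ => (List.mem_append.mp hθ).elim (hl θ) (hl' θ), ?_⟩
  rw [List.foldr_append]
  refine .mp (.mp (thm_foldr_imp_mono φ _ l) ?_) h1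
  exact .mp (.mp (.mp (PropForm.taut (.imp (.imp (.var 0) (.var 1)) (.imp (.imp (.var 1)
    (.imp (.var 2) (.var 3))) (.imp (.var 2) (.imp (.var 0) (.var 3)))))
    ![φ, imp ψ χ, l'.foldr imp ψ, l'.foldr imp χ] (by decide)) h)
    (thm_foldr_imp_mono ψ χ l')) h2

/-- The formula `A = B₁ ∨ … ∨ A = Bₖ`. -/
def eqDisj {α : Ty n} (A : Term C α) (l : List (Term C α)) : Form C :=
  l.foldr (fun B Q => disj (eq A B) Q) fls

theorem thm_eqDisj_congr {α : Ty n} (A B : Term C α) (l : List (Term C α)) :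
    Thm Ax (imp (eq A B) (eq (eqDisj A l) (eqDisj B l))) := by
  obtain ⟨m, hm⟩ : ∃ m, ∀ D ∈ l, varBound D ≤ m :=
    ⟨(l.map varBound).sum, fun D hD => List.le_sum_of_mem (List.mem_map_of_mem hD)⟩
  have key : ∀ D : Term C α, subst m D (eqDisj (var m α) l) = eqDisj D l ∧
      FreeFor m D (eqDisj (var m α) l) := by
    intro D
    induction l with
    | nil => simp [eqDisj]
    | cons B l ih =>
      have hB : ¬ Free m α B := not_free_of_varBound_le (hm B List.mem_cons_self)
      obtain ⟨h1, h2⟩ := ih fun D hD => hm D (List.mem_cons_of_mem _ hD)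
      simp only [eqDisj, List.foldr_cons, subst_disj, freeFor_disj] at h1 h2 ⊢
      simp [subst, FreeFor, subst_of_not_free hB, freeFor_of_not_free hB, h1, h2]
  have h := Thm.leibniz_subst (Ax := Ax) m (key A).2 (key B).2
  rwa [(key A).1, (key B).1] at h

theorem csubst_foldr_imp {D : Ty n → Type v}
    (σ : ∀ α : Ty n, C α → Term D α) (φ : Form C) (l : List (Form C)) :
    (l.foldr imp φ).csubst σ = (l.map fun ψ => ψ.csubst σ).foldr imp (φ.csubst σ) := by
  induction l with
  | nil => rfl
  | cons ψ l ih =>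
    rw [List.map_cons, List.foldr_cons, List.foldr_cons, ← ih]
    rfl

end Derived

/-! ### Provable equations and disequations between words. -/

section Symbolic

variable {n : ℕ} [NeZero n] {N : ℕ} {K : Ty n → Type u}

theorem free_wordT (i : ℕ) (γ : Ty n) (w : List (Fin N)) :
    ¬ Free i γ (wordT w : Term (SymConst N K) (symb n)) := by
  induction w using wordT.induct with
  | case1 => exact id
  | case2 a => exact id
  | case3 a b w ih =>
    simp only [wordT, catT, letterT, Free, or_self, false_or]
    exact ih

theorem catCongr {A B A' B' : Term (SymConst N K) (symb n)} {Ax : Set (Form (SymConst N K))}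
    (h : Thm Ax (eq A A')) (h' : Thm Ax (eq B B')) : Thm Ax (eq (catT A B) (catT A' B')) :=
  .appCongr (.appCongr (.refl _) h) h'

theorem thm_unit (A : Term (SymConst N K) (symb n)) :
    Thm (symAxioms N K) (conj (eq (catT A epsT) A) (eq (catT epsT A) A)) := by
  have h := Thm.inst (B := A)
    (.nonlogical (Ax := symAxioms N K) SymAx.unit) (by simp [FreeFor, catT, epsT])
  simpa [subst, catT, epsT] using h

theorem thm_cat_eps (A : Term (SymConst N K) (symb n)) :
    Thm (symAxioms N K) (eq (catT A epsT) A) := (thm_unit A).conj_left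

theorem thm_eps_cat (A : Term (SymConst N K) (symb n)) :
    Thm (symAxioms N K) (eq (catT epsT A) A) := (thm_unit A).conj_right

/-- Only word terms are inserted: they are closed, so no capture can occur and the successive
substitutions do not interfere. -/
theorem thm_inst₃ {Ax : Set (Form (SymConst N K))} {P : Form (SymConst N K)}
    (h : Thm Ax (all 0 (symb n) (all 1 (symb n) (all 2 (symb n) P))))
    (A B D : List (Fin N)) :
    Thm Ax (subst 2 (wordT D) (subst 1 (wordT B) (subst 0 (wordT A) P))) := by
  have h1 := Thm.inst (B := wordT A) h (freeFor_of_closed fun j γ => free_wordT j γ A)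
  simp only [all, subst, subst_tru, one_ne_zero, OfNat.ofNat_ne_zero, false_and, if_false] at h1
  have h2 := Thm.inst (B := wordT B) h1 (freeFor_of_closed fun j γ => free_wordT j γ B)
  simp only [subst, subst_tru, OfNat.ofNat_ne_one, false_and, if_false] at h2
  exact Thm.inst (B := wordT D) h2 (freeFor_of_closed fun j γ => free_wordT j γ D)

theorem thm_assoc (A B D : List (Fin N)) :
    Thm (symAxioms N K) (eq (catT (catT (wordT A) (wordT B)) (wordT D))
      (catT (wordT A) (catT (wordT B) (wordT D)))) := by
  have h := thm_inst₃ (.nonlogical (Ax := symAxioms N K) SymAx.assoc) A B D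
  simpa [subst, catT, subst_of_not_free (free_wordT _ _ _)] using h

theorem thm_letter_ne {i j : Fin N} (hij : i ≠ j) (A B D : List (Fin N)) :
    Thm (symAxioms N K) (neg (eq (catT (catT (wordT A) (letterT i)) (wordT B))
      (catT (catT (wordT A) (letterT j)) (wordT D)))) := by
  have key : ∀ (i j : Fin N), i < j → ∀ A B D : List (Fin N),
      Thm (symAxioms N K) (neg (eq (catT (catT (wordT A) (letterT i)) (wordT B))
        (catT (catT (wordT A) (letterT j)) (wordT D)))) := by
    intro i j hij A B D
    have h := thm_inst₃ (.nonlogical (Ax := symAxioms N K) (SymAx.distinct i j hij)) A B D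
    simpa [subst, catT, letterT, subst_of_not_free (free_wordT _ _ _)] using h
  rcases hij.lt_or_gt with h | h
  · exact key i j h A B D
  · exact .mp (.mp (PropForm.taut (.imp (.imp (.var 0) (.var 1)) (.imp (.neg (.var 1))
      (.neg (.var 0)))) ![_, _] (by decide)) (.eq_symm_imp _ _)) (key j i h A D B)

theorem thm_wordT_cons (a : Fin N) (w : List (Fin N)) :
    Thm (symAxioms N K) (eq (wordT (a :: w)) (catT (letterT a) (wordT w))) := by
  cases w with
  | nil => exact (thm_cat_eps _).symm
  | cons b w => exact .refl _

theorem thm_wordT_append (w w' : List (Fin N)) :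
    Thm (symAxioms N K) (eq (wordT (w ++ w')) (catT (wordT w) (wordT w'))) := by
  induction w with
  | nil => exact (thm_eps_cat _).symm
  | cons a w ih =>
    exact ((thm_wordT_cons a (w ++ w')).trans (catCongr (.refl _) ih)).trans
      ((thm_assoc [a] w w').symm.trans (catCongr (thm_wordT_cons a w).symm (.refl _)))

/-- The axiom of distinctness refutes `(w + a) + v = (w + b) + v'`; associativity and
`thm_wordT_append` carry this over to the word terms. -/
theorem thm_wordT_ne_of_split {a b : Fin N} (hab : a ≠ b) (w v v' : List (Fin N)) :
    Thm (symAxioms N K) (neg (eq (wordT (w ++ a :: v)) (wordT (w ++ b :: v')))) := by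
  have h : ∀ (a : Fin N) (v : List (Fin N)), Thm (symAxioms N K)
      (eq (catT (catT (wordT w) (letterT a)) (wordT v)) (wordT (w ++ a :: v))) := fun a v =>
    (thm_assoc w [a] v).trans ((catCongr (.refl _) (thm_wordT_cons a v).symm).trans
      (thm_wordT_append w (a :: v)).symm)
  exact (Thm.eqCongr (.refl _) (Thm.eqCongr (h a v) (h b v'))).eqMp (thm_letter_ne hab w v v')

/-- The axioms do not compare a word directly with a proper extension. Appending a letter `b ≠ a` to
both gives `wb` and `wavb`, which differ right after `w`. A second letter is indispensable for this
argument. -/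
theorem thm_wordT_ne_prefix {a b : Fin N} (hab : a ≠ b) (w v : List (Fin N)) :
    Thm (symAxioms N K) (neg (eq (wordT w) (wordT (w ++ a :: v)))) := by
  set w' := w ++ a :: v
  have h := Thm.leibniz_subst (Ax := symAxioms N K) 0 (A := wordT w) (B := wordT w')
    (P := eq (catT (wordT w) (letterT b)) (catT (var 0 _) (letterT b)))
    (freeFor_of_closed fun j γ => free_wordT j γ w)
    (freeFor_of_closed fun j γ => free_wordT j γ w')
  simp only [subst, catT, letterT, subst_of_not_free (free_wordT _ _ _), and_self,
    dite_true] at h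
  have h1 : Thm (symAxioms N K) (neg (eq (catT (wordT w) (letterT b))
      (catT (wordT w') (letterT b)))) := by
    refine (Thm.eqCongr (.refl _) (Thm.eqCongr (thm_wordT_append w [b])
      (thm_wordT_append w' [b]))).eqMp ?_
    simpa [w', neg] using thm_wordT_ne_of_split hab.symm w [] (v ++ [b])
  exact .mp (.mp (.mp (PropForm.taut (.imp (.imp (.var 0) (.iff (.var 1) (.var 2)))
    (.imp (.var 1) (.imp (.neg (.var 2)) (.neg (.var 0))))) ![_, _, _] (by decide)) h)
    (.refl _)) h1

theorem exists_split_of_ne {X : Type*} {w w' : List X} (h : w ≠ w') :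
    (∃ u a b v v', a ≠ b ∧ w = u ++ a :: v ∧ w' = u ++ b :: v') ∨
      (∃ a v, w' = w ++ a :: v) ∨ ∃ a v, w = w' ++ a :: v := by
  induction w generalizing w' with
  | nil =>
    cases w' with
    | nil => exact absurd rfl h
    | cons b v => exact Or.inr (Or.inl ⟨b, v, rfl⟩)
  | cons a w ih =>
    cases w' with
    | nil => exact Or.inr (Or.inr ⟨a, w, rfl⟩)
    | cons b w' =>
      by_cases hab : a = b
      · subst hab
        rcases ih (fun hw => h (by rw [hw])) with ⟨u, c, d, v, v', hcd, rfl, rfl⟩ |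
          ⟨c, v, rfl⟩ | ⟨c, v, rfl⟩
        · exact Or.inl ⟨a :: u, c, d, v, v', hcd, rfl, rfl⟩
        · exact Or.inr (Or.inl ⟨c, v, rfl⟩)
        · exact Or.inr (Or.inr ⟨c, v, rfl⟩)
      · exact Or.inl ⟨[], a, b, w, w', hab, rfl, rfl⟩

/-- Over an alphabet that is not a singleton, distinct words are provably distinct. -/
theorem thm_wordT_ne (hN : N ≠ 1) {w w' : List (Fin N)} (h : w ≠ w') :
    Thm (symAxioms N K) (neg (eq (wordT w) (wordT w'))) := by
  have hex : ∀ a : Fin N, ∃ b, a ≠ b := by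
    intro a
    -- A letter exists, so `N ≠ 0`; together with `N ≠ 1` there are at least two.
    have : Nontrivial (Fin N) := Fin.nontrivial_iff_two_le.mpr (by have := a.pos; omega)
    obtain ⟨b, hb⟩ := exists_ne a
    exact ⟨b, hb.symm⟩
  rcases exists_split_of_ne h with ⟨u, a, b, v, v', hab, rfl, rfl⟩ | ⟨a, v, rfl⟩ | ⟨a, v, rfl⟩
  · exact thm_wordT_ne_of_split hab u v v'
  · obtain ⟨b, hb⟩ := hex a
    exact thm_wordT_ne_prefix hb w v
  · obtain ⟨b, hb⟩ := hex a
    exact .mp (.mp (PropForm.taut (.imp (.imp (.var 0) (.var 1)) (.imp (.neg (.var 1))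
      (.neg (.var 0)))) ![_, _] (by decide)) (.eq_symm_imp _ _)) (thm_wordT_ne_prefix hb w' v)

/-! ### Logical closure. -/

theorem Representable.logicallyClosed {α : Ty n} {L : Lang N K α}
    (h : Representable.{u, v} L) : LogicallyClosed L := by
  obtain ⟨E, Δ, R, -, hR⟩ := h
  intro w A B D hB hD hA
  rw [hR] at hB hD ⊢
  have h1 : Thm (extAxioms N K E) (disj (eq (lift E A) (lift E B)) (eq (lift E A) (lift E D))) :=
    hA.map fun _ c => Sum.inl c
  refine Derives.mp₂ ?_ hB hD
  set H := app R (lift E (wordT w))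
  -- Leibniz's axiom equates `H A` with `H B` if `A = B` and with `H D` if `A = D`; as `H B` and `H
  -- D` are both assumed, either alternative gives `H A`.
  exact .mp (.mp (.mp (PropForm.taut (.imp (.imp (.var 0) (.iff (.var 2) (.var 3)))
    (.imp (.imp (.var 1) (.iff (.var 2) (.var 4))) (.imp (.disj (.var 0) (.var 1))
      (.imp (.var 3) (.imp (.var 4) (.var 2))))))
    ![eq (lift E A) (lift E B), eq (lift E A) (lift E D), app H (lift E A), app H (lift E B),
      app H (lift E D)] (by decide)) (.leibniz _ _ H)) (.leibniz _ _ H)) h1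

/-- Logical closure extends from two to any finite number of alternatives. -/
theorem LogicallyClosed.mem_of_eqDisj {α : Ty n} {L : Lang N K α} (hL : LogicallyClosed L)
    {w : List (Fin N)} {l : List (Term (SymConst N K) α)} (hl : ∀ B ∈ l, (w, B) ∈ L)
    {A : Term (SymConst N K) α} (hA : Thm (symAxioms N K) (eqDisj A l)) : (w, A) ∈ L := by
  induction l generalizing A with
  | nil => exact absurd hA not_thm_fls
  | cons B l ih =>
    have hB := hl B List.mem_cons_self
    cases l with
    | nil =>
      -- A single alternative is used twice.
      exact hL w A B B hB hB (.mp (PropForm.taut (.imp (.disj (.var 0) .fls)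
        (.disj (.var 0) (.var 0))) ![eq A B] (by decide)) hA)
    | cons D l =>
      -- `Z` is `D` if `A = B` and `A` otherwise. In the first case it meets the alternative `D`; in
      -- the second it inherits those of `A` other than `B`. So the induction hypothesis covers `Z`,
      -- and `A = B ∨ A = Z` is provable.
      obtain ⟨Z, hZ, hZ'⟩ := exists_ite (Ax := symAxioms N K) (eq A B) D A
      have hmem : (w, Z) ∈ L := by
        refine ih (fun B' hB' => hl B' (List.mem_cons_of_mem _ hB')) ?_
        exact .mp (.mp (.mp (.mp (PropForm.taut (.imp (.imp (.var 0) (.var 1))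
          (.imp (.imp (.neg (.var 0)) (.var 2)) (.imp (.imp (.var 2)
            (.iff (.disj (.var 1) (.var 3)) (.var 4)))
            (.imp (.disj (.var 0) (.var 4)) (.disj (.var 1) (.var 3))))))
          ![eq A B, eq Z D, eq Z A, eqDisj Z l, eqDisj A (D :: l)] (by decide)) hZ) hZ')
          (thm_eqDisj_congr Z A (D :: l))) hA
      refine hL w A B Z hB hmem ?_
      exact .mp (.mp (PropForm.taut (.imp (.imp (.neg (.var 0)) (.var 1))
        (.imp (.imp (.var 1) (.var 2)) (.disj (.var 0) (.var 2))))
        ![eq A B, eq Z A, eq A Z] (by decide)) hZ') (.eq_symm_imp Z A)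

/-! ### Finite graphs and elimination of the new constant. -/

/-- The formula `(X = w₁ ∧ Y = A₁) ∨ … ∨ (X = wₖ ∧ Y = Aₖ)`. -/
def graphDisj {α : Ty n} (X : Term (SymConst N K) (symb n)) (Y : Term (SymConst N K) α)
    (l : List (List (Fin N) × Term (SymConst N K) α)) : Form (SymConst N K) :=
  l.foldr (fun p Q => disj (conj (eq X (wordT p.1)) (eq Y p.2)) Q) fls

theorem thm_graphDisj {α : Ty n} {l : List (List (Fin N) × Term (SymConst N K) α)}
    {p : List (Fin N) × Term (SymConst N K) α} (hp : p ∈ l) :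
    Thm (symAxioms N K) (graphDisj (wordT p.1) p.2 l) := by
  induction l with
  | nil => simp at hp
  | cons q l ih =>
    rcases List.mem_cons.mp hp with rfl | h
    · exact .mp (.mp (PropForm.taut (.imp (.var 0) (.imp (.var 1)
        (.disj (.conj (.var 0) (.var 1)) (.var 2)))) ![_, _, _] (by decide)) (.refl _)) (.refl _)
    · exact .mp (PropForm.taut (.imp (.var 1) (.disj (.var 0) (.var 1))) ![_, _] (by decide))
        (ih h)

/-- Disjuncts that belong to another word are refuted by `thm_wordT_ne`; the others are weakened to
their second conjunct. -/
theorem thm_eqDisj_of_graphDisj (hN : N ≠ 1) {α : Ty n} (w : List (Fin N))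
    (A : Term (SymConst N K) α) (l : List (List (Fin N) × Term (SymConst N K) α)) :
    Thm (symAxioms N K) (imp (graphDisj (wordT w) A l)
      (eqDisj A ((l.filter fun p => p.1 = w).map Prod.snd))) := by
  induction l with
  | nil => exact PropForm.taut (.imp (.var 0) (.var 0)) ![fls] (by decide)
  | cons p l ih =>
    by_cases h : p.1 = w
    · rw [List.filter_cons_of_pos (by simpa using h), List.map_cons]
      exact .mp (PropForm.taut (.imp (.imp (.var 0) (.var 1))
        (.imp (.disj (.conj (.var 2) (.var 3)) (.var 0)) (.disj (.var 3) (.var 1))))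
        ![_, _, _, _] (by decide)) ih
    · rw [List.filter_cons_of_neg (by simpa using h)]
      exact .mp (.mp (PropForm.taut (.imp (.imp (.var 0) (.var 1)) (.imp (.neg (.var 2))
        (.imp (.disj (.conj (.var 2) (.var 3)) (.var 0)) (.var 1))))
        ![_, _, _, _] (by decide)) ih) (thm_wordT_ne hN (Ne.symm h))

/-- The graph of a finite relation is definable by a term. -/
theorem exists_graph {α : Ty n} (l : List (List (Fin N) × Term (SymConst N K) α)) :
    ∃ D : Term (SymConst N K) (Ty.fn (symb n) (Ty.fn α Ty.t)),
      ∀ (w : List (Fin N)) (A : Term (SymConst N K) α),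
        Thm (symAxioms N K) (eq (app (app D (wordT w)) A) (graphDisj (wordT w) A l)) := by
  obtain ⟨m, hm⟩ : ∃ m, ∀ p ∈ l, varBound p.2 ≤ m :=
    ⟨(l.map fun p => varBound p.2).sum, fun p hp =>
      List.le_sum_of_mem (List.mem_map_of_mem (f := fun p => varBound p.2) hp)⟩
  refine ⟨lam m (symb n) (lam (m + 1) α (graphDisj (var m _) (var (m + 1) _) l)),
    fun w A => ?_⟩
  have h1 : subst m (wordT w) (graphDisj (var m _) (var (m + 1) α) l) =
      graphDisj (wordT w) (var (m + 1) α) l := by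
    induction l with
    | nil => simp [graphDisj]
    | cons p l ih =>
      have hp : ¬ Free m (symb n) p.2 := not_free_of_varBound_le (hm p List.mem_cons_self)
      have h1 := ih fun D hD => hm D (List.mem_cons_of_mem _ hD)
      simp only [graphDisj, List.foldr_cons, subst_disj] at h1 ⊢
      simp [subst, subst_of_not_free hp, subst_of_not_free (free_wordT _ _ _), h1]
  have h2 : subst (m + 1) A (graphDisj (wordT w) (var (m + 1) α) l) = graphDisj (wordT w) A l ∧
      FreeFor (m + 1) A (graphDisj (wordT w) (var (m + 1) α) l) := by
    clear h1
    induction l with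
    | nil => simp [graphDisj]
    | cons p l ih =>
      have hp : ¬ Free (m + 1) α p.2 :=
        not_free_of_varBound_le ((hm p List.mem_cons_self).trans (Nat.le_succ m))
      obtain ⟨h1, h2⟩ := ih fun D hD => hm D (List.mem_cons_of_mem _ hD)
      simp only [graphDisj, List.foldr_cons, subst_disj, freeFor_disj] at h1 h2 ⊢
      simp [subst, FreeFor, subst_of_not_free hp, freeFor_of_not_free hp,
        subst_of_not_free (free_wordT _ _ _), freeFor_of_not_free (free_wordT _ _ _), h1, h2]
  have hb := Thm.beta (Ax := symAxioms N K) m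
    (lam (m + 1) α (graphDisj (var m _) (var (m + 1) α) l)) (wordT w)
    (freeFor_of_closed fun j γ => free_wordT j γ w)
  simp only [subst, Nat.succ_ne_self, false_and, if_false, h1] at hb
  have hb' := Thm.beta (Ax := symAxioms N K) (m + 1) _ A h2.2
  rw [h2.1] at hb'
  exact (Thm.appCongr hb (.refl A)).trans hb'

/-- A derivation from formulas `f wᵢ Aᵢ` with a new constant `f` stays one if `f` is replaced by any
term. -/
theorem thm_foldr_imp_of_const {E : Ty n → Type v} {α : Ty n}
    {c : E (Ty.fn (symb n) (Ty.fn α Ty.t))}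
    {l : List (List (Fin N) × Term (SymConst N K) α)} {w : List (Fin N)}
    {A : Term (SymConst N K) α}
    (h : Thm (extAxioms N K E) ((l.map fun p =>
      app (app (const (Sum.inr c)) (lift E (wordT p.1))) (lift E p.2)).foldr imp
        (app (app (const (Sum.inr c)) (lift E (wordT w))) (lift E A))))
    (D : Term (SymConst N K) (Ty.fn (symb n) (Ty.fn α Ty.t))) :
    Thm (symAxioms N K) ((l.map fun p => app (app D (wordT p.1)) p.2).foldr imp
      (app (app D (wordT w)) A)) := by
  obtain ⟨M, hM⟩ := h.csubst (D := SymConst N K)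
  obtain ⟨m, hm, hA, hl⟩ : ∃ m, M ≤ m ∧ varBound A ≤ m ∧ ∀ p ∈ l, varBound p.2 ≤ m :=
    ⟨M + varBound A + (l.map fun p => varBound p.2).sum, by omega, by omega, fun p hp =>
      (List.le_sum_of_mem (List.mem_map_of_mem (f := fun p => varBound p.2) hp)).trans
        (by omega)⟩
  -- Putting `D` for the constant at once could let abstractions in the derivation capture its free
  -- variables. So a variable beyond the bound `M` goes in first. All additional constants of one
  -- type may share it.
  let σ : ∀ β : Ty n, ExtConst N K E β → Term (SymConst N K) β :=
    fun β => Sum.elim (fun c => const c) fun _ => var m β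
  have hσ : ∀ {β : Ty n} (B : Term (SymConst N K) β), (lift E B).csubst σ = B := by
    intro β B
    rw [lift, csubst_map]
    exact csubst_const B
  have h1 := hM (symAxioms N K) σ
    (by
      rintro β (c | c) i γ hf
      · exact hf.elim
      · exact hm.trans hf.1.le)
    (by
      rintro _ ⟨ψ, hψ, rfl⟩
      rw [hσ]
      exact .nonlogical hψ)
  rw [csubst_foldr_imp, List.map_map] at h1
  have hs : ∀ (w : List (Fin N)) (B : Term (SymConst N K) α), varBound B ≤ m →
      subst m D ((app (app (const (Sum.inr c)) (lift E (wordT w))) (lift E B)).csubst σ) =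
        app (app D (wordT w)) B ∧
      FreeFor m D ((app (app (const (Sum.inr c)) (lift E (wordT w))) (lift E B)).csubst σ) := by
    intro w B hB
    have hB' : ¬ Free m (Ty.fn (symb n) (Ty.fn α Ty.t)) B := not_free_of_varBound_le hB
    have hw := free_wordT (K := K) m (Ty.fn (symb n) (Ty.fn α Ty.t)) w
    simp only [csubst, hσ, σ, Sum.elim_inr, subst, FreeFor, subst_of_not_free hB',
      subst_of_not_free hw, and_self, dite_true, true_and]
    exact ⟨freeFor_of_not_free hw, freeFor_of_not_free hB'⟩
  -- Now `D` is substituted in the final theorem only. There the variable `m` of type `sαt` occurs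
  -- just as head of the applications, outside every abstraction, so nothing is captured.
  suffices H : subst m D ((l.map ((fun ψ => ψ.csubst σ) ∘ fun p =>
      app (app (const (Sum.inr c)) (lift E (wordT p.1))) (lift E p.2))).foldr imp
        ((app (app (const (Sum.inr c)) (lift E (wordT w))) (lift E A)).csubst σ)) =
      (l.map fun p => app (app D (wordT p.1)) p.2).foldr imp (app (app D (wordT w)) A) ∧
      FreeFor m D ((l.map ((fun ψ => ψ.csubst σ) ∘ fun p =>
      app (app (const (Sum.inr c)) (lift E (wordT p.1))) (lift E p.2))).foldr imp
        ((app (app (const (Sum.inr c)) (lift E (wordT w))) (lift E A)).csubst σ)) by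
    rw [← H.1]
    exact h1.subst H.2
  clear h h1 hM
  induction l with
  | nil => exact hs w A hA
  | cons p l ih =>
    obtain ⟨h1, h2⟩ := ih fun q hq => hl q (List.mem_cons_of_mem _ hq)
    obtain ⟨h3, h4⟩ := hs p.1 p.2 (hl p List.mem_cons_self)
    simp only [List.map_cons, List.foldr_cons, subst_imp, freeFor_imp, Function.comp_apply]
    exact ⟨congrArg₂ imp h3 h1, h4, h2⟩

theorem LogicallyClosed.representedBy (hN : N ≠ 1) {α : Ty n} {L : Lang N K α}
    (hL : LogicallyClosed L) (E : Ty n → Type v) (c : E (Ty.fn (symb n) (Ty.fn α Ty.t))) :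
    RepresentedBy E (langAxioms E c L) (const (Sum.inr c)) L := by
  refine ⟨consistent_langAxioms E c L, fun w A => ⟨fun h => ?_, ?_⟩⟩
  · refine ⟨[app (app (const (Sum.inr c)) (lift E (wordT w))) (lift E A)], ?_, ?_⟩
    · rintro ψ hψ
      exact ⟨w, A, h, List.mem_singleton.mp hψ⟩
    · exact PropForm.taut (.imp (.var 0) (.var 0)) ![_] (by decide)
  · rintro ⟨l, hl, h⟩
    obtain ⟨l', hl', rfl⟩ : ∃ l' : List (List (Fin N) × Term (SymConst N K) α),
        (∀ p ∈ l', p ∈ L) ∧ l = l'.map fun p =>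
          app (app (const (Sum.inr c)) (lift E (wordT p.1))) (lift E p.2) := by
      clear h
      induction l with
      | nil => exact ⟨[], by simp, rfl⟩
      | cons ψ l ih =>
        obtain ⟨l', hl', rfl⟩ := ih fun φ hφ => hl φ (List.mem_cons_of_mem _ hφ)
        obtain ⟨w, A, hA, rfl⟩ := hl ψ List.mem_cons_self
        exact ⟨(w, A) :: l', List.forall_mem_cons.mpr ⟨hA, hl'⟩, rfl⟩
    -- The graph of exactly the pairs used as hypotheses: it makes each hypothesis a theorem and the
    -- conclusion as strong as possible.
    obtain ⟨D, hD⟩ := exists_graph l'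
    have h1 := (hD w A).eqMp (Thm.of_foldr_imp (by
      intro ψ hψ
      obtain ⟨p, hp, rfl⟩ := List.mem_map.mp hψ
      exact (hD p.1 p.2).symm.eqMp (thm_graphDisj hp)) (thm_foldr_imp_of_const h D))
    refine hL.mem_of_eqDisj ?_ ((thm_eqDisj_of_graphDisj hN w A l').mp h1)
    intro B hB
    obtain ⟨p, hp, rfl⟩ := List.mem_map.mp hB
    obtain ⟨hp1, hp2⟩ := List.mem_filter.mp hp
    have hw : p.1 = w := by simpa using hp2
    rw [← hw]
    exact hl' p hp1

end Symbolic

end TyN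

theorem theorem5p5 {n : ℕ} [NeZero n] (N : ℕ) (K : TyN.Ty n → Type u) (α : TyN.Ty n)
    (L : TyN.Lang N K α) :
    (TyN.Representable.{u, v} L → TyN.LogicallyClosed L) ∧
    (N ≠ 1 → TyN.LogicallyClosed L →
      ∀ (E : TyN.Ty n → Type v) (c : E (TyN.Ty.fn (TyN.symb n) (TyN.Ty.fn α TyN.Ty.t))),
        TyN.RepresentedBy E (TyN.langAxioms E c L) (TyN.Term.const (Sum.inr c)) L) ∧
    (N ≠ 1 → (TyN.Representable.{u, v} L ↔ TyN.LogicallyClosed L)) :=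
  ⟨TyN.Representable.logicallyClosed, fun hN hL E c => hL.representedBy hN E c, fun hN =>
    ⟨TyN.Representable.logicallyClosed, fun hL =>
      -- One additional constant of each type is adjoined, in particular one of type `sαt`.
      ⟨fun _ => PUnit, _, _, hL.representedBy hN (fun _ => PUnit) PUnit.unit⟩⟩⟩
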